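/- Let $\mathbb{K}$ be a field of characteristic zero and let $\mathcal{Q}$ be a finite forest poset, i.e. a finite poset with no three elements $a, b, c$ such that $a \prec c$, $b \prec c$ and $a$, $b$ are incomparable. For comparable $a, b \in \mathcal{Q}$ write $a \uparrow b := \min(a,b)$. Let $\mathsf{As}(\mathcal{Q})$ be the nonsymmetric operad over $\mathbb{K}$ with generators $\star_a$, $a \in \mathcal{Q}$, all of arity $2$, and relations $$\star_a \circ_1 \star_b = \star_{a \uparrow b} \circ_2 \star_{a \uparrow b}, \qquad \star_{a \uparrow b} \circ_1 \star_{a \uparrow b} = \star_a \circ_2 \star_b, \qquad a, b \in \mathcal{Q} \text{ comparable},$$ that is, the quotient of the free nonsymmetric operad on the $\star_a$ by the operad ideal generated by these relations. A $\mathcal{Q}$-Schröder tree is a planar rooted tree in which every internal node has at least two children and carries a label in $\mathcal{Q}$; it is $\mathcal{Q}$-alternating if the labels of any internal node and of any of its internal children are incomparable. Let $\to$ be the relation on $\mathcal{Q}$-Schröder trees such that $\mathfrak{s} \to \mathfrak{t}$ if $\mathfrak{t}$ is obtained from $\mathfrak{s}$ by contracting an edge between an internal node labeled by $b$ and an internal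 child of it labeled by some $a$ comparable with $b$ (the children of the child take its place, in order), and labeling the resulting node by $a \uparrow b$. For $n \geq 1$, let $\mathsf{ASchr}(\mathcal{Q})(n)$ be the $\mathbb{K}$-vector space with basis the $\mathcal{Q}$-alternating Schröder trees with $n$ leaves. For two such trees $\mathfrak{s}$ and $\mathfrak{t}$, let $\mathfrak{s} \circ_i \mathfrak{t}$ be the normal form for $\to$ of the tree obtained by grafting the root of $\mathfrak{t}$ on the $i$th leaf of $\mathfrak{s}$, and extend $\circ_i$ bilinearly; the unit is the tree consisting of one leaf. Theorem. The relation $\to$ is convergent (terminating and confluent) and its normal forms are exactly the $\mathcal{Q}$-alternating Schröder trees. The spaces $\mathsf{ASchr}(\mathcal{Q})(n)$, with these partial compositions and this unit, form a nonsymmetric operad $\mathsf{ASchr}(\mathcal{Q})$, and the operads $\mathsf{As}(\mathcal{Q})$ and $\mathsf{ASchr}(\mathcal{Q})$ are isomorphic. -/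

import Mathlib

/-! ### Posets -/

/-- A forest poset: no element lies above two incomparable elements, i.e. no three elements
`a`, `b`, `c` form the pattern `a < c`, `b < c`, `a` and `b` incomparable. -/
def IsForestPoset (Q : Type*) [PartialOrder Q] : Prop :=
  ¬ ∃ a b c : Q, a < c ∧ b < c ∧ IncompRel (· ≤ ·) a b

open Classical in
/-- The minimum of two elements of a poset; it is only used for comparable elements. -/
noncomputable def upMin {Q : Type*} [PartialOrder Q] (a b : Q) : Q :=
  if a ≤ b then a else b

/-! ### Rewriting -/

/-- There is no infinite chain of rewriting steps. -/
def IsTerminating {S : Type*} (r : S → S → Prop) : Prop :=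
  ¬ ∃ f : ℕ → S, ∀ k, r (f k) (f (k + 1))

def IsConfluent {S : Type*} (r : S → S → Prop) : Prop :=
  ∀ t r₁ r₂ : S, Relation.ReflTransGen r t r₁ → Relation.ReflTransGen r t r₂ →
    ∃ t' : S, Relation.ReflTransGen r r₁ t' ∧ Relation.ReflTransGen r r₂ t'

def IsConvergent {S : Type*} (r : S → S → Prop) : Prop :=
  IsTerminating r ∧ IsConfluent r

def IsNormalForm {S : Type*} (r : S → S → Prop) (t : S) : Prop :=
  ∀ t' : S, ¬ r t t'

/-! ### Nonsymmetric operads -/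

/-- The data of a nonsymmetric operad over `K`: vector spaces `space n` of elements of arity `n`,
bilinear partial compositions and a unit. The composition `comp i h x y` is `x ∘_{i+1} y`
(inputs are numbered from `0`); the equation `h : n + m = p + 1` says that `p = n + m - 1`. -/
structure OperadData.{v, w} (K : Type v) [Field K] where
  space : ℕ → Type w
  [addCommGroup : ∀ n, AddCommGroup (space n)]
  [module : ∀ n, Module K (space n)]
  comp : ∀ {n m p : ℕ} (_ : Fin n) (_ : n + m = p + 1), space n →ₗ[K] space m →ₗ[K] space p
  one : space 1

namespace OperadData

attribute [instance] OperadData.addCommGroup OperadData.module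

variable {K : Type*} [Field K]

/-- The axioms of a nonsymmetric operad (concentrated in arities at least `1`). -/
structure IsOperad (O : OperadData K) : Prop where
  arity_zero : Subsingleton (O.space 0)
  /-- `(x ∘_i y) ∘_{i+j-1} z = x ∘_i (y ∘_j z)`, with `i` and `j` numbered from `1`. -/
  comp_assoc : ∀ {n m k p q r : ℕ} (i : Fin n) (j : Fin m)
    (h₁ : n + m = p + 1) (h₂ : p + k = q + 1) (h₃ : m + k = r + 1) (h₄ : n + r = q + 1)
    (x : O.space n) (y : O.space m) (z : O.space k),
    O.comp ⟨i + j, by have := i.2; have := j.2; omega⟩ h₂ (O.comp i h₁ x y) z =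
      O.comp i h₄ x (O.comp j h₃ y z)
  /-- `(x ∘_i y) ∘_{j+m-1} z = (x ∘_j z) ∘_i y` for `i < j`, with `i` and `j` numbered
  from `1`. -/
  comp_comm : ∀ {n m k p q r : ℕ} (i j : Fin n) (hij : i < j)
    (h₁ : n + m = p + 1) (h₂ : p + k = q + 1) (h₃ : n + k = r + 1) (h₄ : r + m = q + 1)
    (x : O.space n) (y : O.space m) (z : O.space k),
    O.comp ⟨j + m - 1, by have := j.2; have : i.1 < j.1 := hij; omega⟩ h₂ (O.comp i h₁ x y) z =
      O.comp ⟨i, by have := j.2; have : i.1 < j.1 := hij; omega⟩ h₄ (O.comp j h₃ x z) y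
  one_comp : ∀ {n : ℕ} (x : O.space n), O.comp (0 : Fin 1) (Nat.add_comm 1 n) O.one x = x
  comp_one : ∀ {n : ℕ} (i : Fin n) (x : O.space n), O.comp i rfl x O.one = x

/-- Isomorphisms of operads. -/
structure Iso (O P : OperadData K) where
  equiv : ∀ n, O.space n ≃ₗ[K] P.space n
  map_one : equiv 1 O.one = P.one
  map_comp : ∀ {n m p : ℕ} (i : Fin n) (h : n + m = p + 1) (x : O.space n) (y : O.space m),
    equiv p (O.comp i h x y) = P.comp i h (equiv n x) (equiv m y)

/-- A graded subspace is an operad ideal if it is stable under composition, on either side, with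
arbitrary elements. -/
structure IsIdeal (O : OperadData K) (I : ∀ n, Submodule K (O.space n)) : Prop where
  comp_mem_right : ∀ {n m p : ℕ} (i : Fin n) (h : n + m = p + 1) (x : O.space n),
    ∀ y ∈ I m, O.comp i h x y ∈ I p
  comp_mem_left : ∀ {n m p : ℕ} (i : Fin n) (h : n + m = p + 1), ∀ x ∈ I n,
    ∀ y : O.space m, O.comp i h x y ∈ I p

/-- The operad ideal generated by a graded subspace `R`: the intersection of all the operad ideals
that contain `R`. -/
def idealSpan (O : OperadData K) (R : ∀ n, Submodule K (O.space n)) (n : ℕ) :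
    Submodule K (O.space n) :=
  sInf {J | ∃ I : ∀ n, Submodule K (O.space n), O.IsIdeal I ∧ (∀ k, R k ≤ I k) ∧ J = I n}

theorem isIdeal_idealSpan (O : OperadData K) (R : ∀ n, Submodule K (O.space n)) :
    O.IsIdeal (O.idealSpan R) where
  comp_mem_right := by
    intro n m p i h x y hy
    refine Submodule.mem_sInf.2 ?_
    rintro J ⟨I, hI, hR, rfl⟩
    exact hI.comp_mem_right i h x y (Submodule.mem_sInf.1 hy _ ⟨I, hI, hR, rfl⟩)
  comp_mem_left := by
    intro n m p i h x hx y
    refine Submodule.mem_sInf.2 ?_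
    rintro J ⟨I, hI, hR, rfl⟩
    exact hI.comp_mem_left i h x (Submodule.mem_sInf.1 hx _ ⟨I, hI, hR, rfl⟩) y

/-- The quotient of an operad by an operad ideal, with the composition
`[x] ∘_i [y] = [x ∘_i y]`. -/
def quotient (O : OperadData K) (I : ∀ n, Submodule K (O.space n)) (hI : O.IsIdeal I) :
    OperadData K where
  space n := O.space n ⧸ I n
  comp {n m p} i h :=
    (I n).liftQ
      (Submodule.mapQLinear (I m) (I p) ∘ₗ
        (O.comp i h).codRestrict (Submodule.compatibleMaps (I m) (I p))
          (fun x y hy => hI.comp_mem_right i h x y hy))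
      (by
        intro x hx
        refine LinearMap.mem_ker.2 (LinearMap.ext fun y => ?_)
        obtain ⟨y, rfl⟩ := Submodule.Quotient.mk_surjective _ y
        exact (Submodule.Quotient.mk_eq_zero _).2 (hI.comp_mem_left i h x hx y))
  one := Submodule.Quotient.mk O.one

theorem quotient_comp_mk (O : OperadData K) (I : ∀ n, Submodule K (O.space n)) (hI : O.IsIdeal I)
    {n m p : ℕ} (i : Fin n) (h : n + m = p + 1) (x : O.space n) (y : O.space m) :
    (O.quotient I hI).comp i h (Submodule.Quotient.mk x) (Submodule.Quotient.mk y) =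
      Submodule.Quotient.mk (O.comp i h x y) :=
  rfl

end OperadData

/-- The bilinear map between spaces of formal linear combinations that extends a map `f` on basis
elements. -/
noncomputable def bilinExt (K : Type*) [Field K] {A B C : Type*} (f : A → B → C) :
    (A →₀ K) →ₗ[K] (B →₀ K) →ₗ[K] (C →₀ K) :=
  Finsupp.linearCombination K fun a =>
    Finsupp.linearCombination K fun b => Finsupp.single (f a b) (1 : K)

theorem bilinExt_single (K : Type*) [Field K] {A B C : Type*} (f : A → B → C) (a : A) (b : B) :
    bilinExt K f (Finsupp.single a 1) (Finsupp.single b 1) = Finsupp.single (f a b) 1 := by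
  simp [bilinExt]

/-! ### The operad `As(Q)` by generators and relations

The generators `⋆_a`, `a ∈ Q`, all have arity `2`, so that the syntax trees on them are the planar
binary trees whose internal nodes are labeled by `Q`. -/

/-- Grafting of the root of `t` on the leaf number `i` of `s` (leaves are numbered from `0`, from
left to right). -/
def BinaryTree.graft {Q : Type*} (t : BinaryTree Q) : BinaryTree Q → ℕ → BinaryTree Q
  | .nil, _ => t
  | .node a l r, i =>
    if i < l.numLeaves then .node a (BinaryTree.graft t l i) r
    else .node a l (BinaryTree.graft t r (i - l.numLeaves))

theorem BinaryTree.numLeaves_graft {Q : Type*} (t : BinaryTree Q) :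
    ∀ (s : BinaryTree Q) (i : ℕ), i < s.numLeaves →
      (BinaryTree.graft t s i).numLeaves + 1 = s.numLeaves + t.numLeaves
  | .nil, i, h => by simp [BinaryTree.graft, Nat.add_comm]
  | .node a l r, i, h => by
    simp only [BinaryTree.numLeaves] at h
    by_cases hi : i < l.numLeaves
    · have := BinaryTree.numLeaves_graft t l i hi
      simp only [BinaryTree.graft, hi, if_true, BinaryTree.numLeaves]
      omega
    · have := BinaryTree.numLeaves_graft t r (i - l.numLeaves) (by omega)
      simp only [BinaryTree.graft, hi, if_false, BinaryTree.numLeaves]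
      omega

/-- Syntax trees of arity `n` on the generators `⋆_a`, `a ∈ Q`. -/
abbrev SyntaxTree (Q : Type*) (n : ℕ) : Type _ :=
  {t : BinaryTree Q // t.numLeaves = n}

def SyntaxTree.graft {Q : Type*} {n m p : ℕ} (i : Fin n) (h : n + m = p + 1)
    (s : SyntaxTree Q n) (t : SyntaxTree Q m) : SyntaxTree Q p :=
  ⟨BinaryTree.graft t.1 s.1 i, by
    have h₁ := BinaryTree.numLeaves_graft t.1 s.1 i (by rw [s.2]; exact i.2)
    have h₂ := s.2
    have h₃ := t.2
    omega⟩

/-- The free operad on the generators `⋆_a`, `a ∈ Q`, of arity `2`. -/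
noncomputable def freeOperad (K : Type*) [Field K] (Q : Type*) : OperadData K where
  space n := SyntaxTree Q n →₀ K
  comp i h := bilinExt K (SyntaxTree.graft i h)
  one := Finsupp.single ⟨.nil, rfl⟩ 1

/-- The generator `⋆_a`. -/
noncomputable def star (K : Type*) [Field K] {Q : Type*} (a : Q) : (freeOperad K Q).space 2 :=
  Finsupp.single (⟨.node a .nil .nil, rfl⟩ : SyntaxTree Q 2) (1 : K)

/-- The space of relations of `As(Q)`, spanned by `⋆_a ∘₁ ⋆_b - ⋆_{a↑b} ∘₂ ⋆_{a↑b}` and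
`⋆_{a↑b} ∘₁ ⋆_{a↑b} - ⋆_a ∘₂ ⋆_b` for all comparable `a` and `b`. It is nonzero in arity `n = 3`
only, by the equation `2 + 2 = n + 1`. -/
noncomputable def asRelations (K : Type*) [Field K] (Q : Type*) [PartialOrder Q] (n : ℕ) :
    Submodule K ((freeOperad K Q).space n) :=
  Submodule.span K {x | ∃ (h : 2 + 2 = n + 1) (a b : Q), (a ≤ b ∨ b ≤ a) ∧
    (x = (freeOperad K Q).comp 0 h (star K a) (star K b) -
        (freeOperad K Q).comp 1 h (star K (upMin a b)) (star K (upMin a b)) ∨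
      x = (freeOperad K Q).comp 0 h (star K (upMin a b)) (star K (upMin a b)) -
        (freeOperad K Q).comp 1 h (star K a) (star K b))}

/-- The `Q`-associative operad. -/
noncomputable def AsOperad (K : Type*) [Field K] (Q : Type*) [PartialOrder Q] : OperadData K :=
  (freeOperad K Q).quotient ((freeOperad K Q).idealSpan (asRelations K Q))
    ((freeOperad K Q).isIdeal_idealSpan (asRelations K Q))

/-! ### Schröder trees -/

/-- Planar rooted trees whose internal nodes are labeled by `Q`; `node a ts` is the tree whose root
is labeled by `a` and has the list `ts` of subtrees, from left to right. -/
inductive LTree (Q : Type*) where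
  | leaf : LTree Q
  | node (a : Q) (ts : List (LTree Q)) : LTree Q

namespace LTree

variable {Q : Type*}

mutual
/-- The number of leaves. -/
def numLeaves : LTree Q → ℕ
  | .leaf => 1
  | .node _ ts => numLeavesList ts
/-- The total number of leaves of a list of trees. -/
def numLeavesList : List (LTree Q) → ℕ
  | [] => 0
  | t :: ts => numLeaves t + numLeavesList ts
end

mutual
/-- Grafting of the root of `t` on the leaf number `i` of a tree (leaves are numbered from `0`,
from left to right). -/
def graft (t : LTree Q) : LTree Q → ℕ → LTree Q
  | .leaf, _ => t
  | .node a ss, i => .node a (graftList t ss i)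
/-- Grafting of the root of `t` on the leaf number `i` of a list of trees. -/
def graftList (t : LTree Q) : List (LTree Q) → ℕ → List (LTree Q)
  | [], _ => []
  | s :: ss, i =>
    if i < numLeaves s then graft t s i :: ss else s :: graftList t ss (i - numLeaves s)
end

/-- All internal nodes have at least two children. -/
inductive IsSchroder : LTree Q → Prop
  | leaf : IsSchroder .leaf
  | node (a : Q) (ts : List (LTree Q)) : 2 ≤ ts.length → (∀ t ∈ ts, IsSchroder t) →
      IsSchroder (.node a ts)

/-- The labels of an internal node and of any internal node that is a child of it are
incomparable. -/
inductive IsAlternating [PartialOrder Q] : LTree Q → Prop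
  | leaf : IsAlternating .leaf
  | node (a : Q) (ts : List (LTree Q)) :
      (∀ b us, LTree.node b us ∈ ts → IncompRel (· ≤ ·) a b) →
      (∀ t ∈ ts, IsAlternating t) → IsAlternating (.node a ts)

/-- One step of rewriting: somewhere in the tree, a node labeled by `b` absorbs one of its children,
labeled by an element `a` comparable with `b`, and is relabeled by the minimum of `a` and `b`. -/
inductive Step [PartialOrder Q] : LTree Q → LTree Q → Prop
  | root (a b : Q) (l us r : List (LTree Q)) : a ≤ b ∨ b ≤ a →
      Step (.node b (l ++ .node a us :: r)) (.node (upMin a b) (l ++ us ++ r))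
  | child (c : Q) (l r : List (LTree Q)) (s s' : LTree Q) : Step s s' →
      Step (.node c (l ++ s :: r)) (.node c (l ++ s' :: r))

mutual
/-- The number of internal nodes. -/
def numNodes : LTree Q → ℕ
  | .leaf => 0
  | .node _ ts => numNodesList ts + 1
/-- The total number of internal nodes of a list of trees. -/
def numNodesList : List (LTree Q) → ℕ
  | [] => 0
  | t :: ts => numNodes t + numNodesList ts
end

theorem numLeavesList_append (l r : List (LTree Q)) :
    numLeavesList (l ++ r) = numLeavesList l + numLeavesList r := by
  induction l with
  | nil => simp [numLeavesList]
  | cons t l ih => simp [numLeavesList, ih, Nat.add_assoc]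

theorem numNodesList_append (l r : List (LTree Q)) :
    numNodesList (l ++ r) = numNodesList l + numNodesList r := by
  induction l with
  | nil => simp [numNodesList]
  | cons t l ih => simp [numNodesList, ih, Nat.add_assoc]

mutual
theorem numLeaves_graft (t : LTree Q) : ∀ (s : LTree Q) (i : ℕ), i < s.numLeaves →
    (graft t s i).numLeaves + 1 = s.numLeaves + t.numLeaves
  | .leaf, i, _ => by simp [graft, numLeaves, Nat.add_comm]
  | .node a ss, i, h => by
    simp only [numLeaves] at h
    simpa [graft, numLeaves] using numLeavesList_graftList t ss i h
theorem numLeavesList_graftList (t : LTree Q) : ∀ (ss : List (LTree Q)) (i : ℕ),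
    i < numLeavesList ss →
    numLeavesList (graftList t ss i) + 1 = numLeavesList ss + t.numLeaves
  | [], i, h => by simp [numLeavesList] at h
  | s :: ss, i, h => by
    simp only [numLeavesList] at h
    by_cases hi : i < s.numLeaves
    · have := numLeaves_graft t s i hi
      simp only [graftList, hi, if_true, numLeavesList]
      omega
    · have := numLeavesList_graftList t ss (i - s.numLeaves) (by omega)
      simp only [graftList, hi, if_false, numLeavesList]
      omega
end

theorem length_graftList (t : LTree Q) : ∀ (ss : List (LTree Q)) (i : ℕ),
    (graftList t ss i).length = ss.length
  | [], i => by simp [graftList]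
  | s :: ss, i => by
    by_cases hi : i < s.numLeaves
    · simp [graftList, hi]
    · simp [graftList, hi, length_graftList t ss]

theorem isSchroder_node {a : Q} {ts : List (LTree Q)} :
    IsSchroder (.node a ts) ↔ 2 ≤ ts.length ∧ ∀ t ∈ ts, IsSchroder t :=
  ⟨fun h => by cases h with | node _ _ h₁ h₂ => exact ⟨h₁, h₂⟩, fun h => .node a ts h.1 h.2⟩

mutual
theorem IsSchroder.graft {t : LTree Q} (ht : IsSchroder t) : ∀ (s : LTree Q) (i : ℕ),
    IsSchroder s → IsSchroder (LTree.graft t s i)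
  | .leaf, i, _ => by simpa [LTree.graft] using ht
  | .node a ss, i, h => by
    rw [isSchroder_node] at h
    rw [LTree.graft, isSchroder_node, length_graftList]
    exact ⟨h.1, IsSchroder.graftList ht ss i h.2⟩
theorem IsSchroder.graftList {t : LTree Q} (ht : IsSchroder t) : ∀ (ss : List (LTree Q)) (i : ℕ),
    (∀ s ∈ ss, IsSchroder s) → ∀ s ∈ LTree.graftList t ss i, IsSchroder s
  | [], i, _ => by simp [LTree.graftList]
  | s :: ss, i, h => by
    rw [List.forall_mem_cons] at h
    by_cases hi : i < s.numLeaves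
    · simp only [LTree.graftList, hi, if_true, List.forall_mem_cons]
      exact ⟨IsSchroder.graft ht s i h.1, h.2⟩
    · simp only [LTree.graftList, hi, if_false, List.forall_mem_cons]
      exact ⟨h.1, IsSchroder.graftList ht ss _ h.2⟩
end

theorem Step.numLeaves_eq [PartialOrder Q] {s t : LTree Q} (h : Step s t) :
    t.numLeaves = s.numLeaves := by
  induction h with
  | root a b l us r h =>
    simp only [numLeaves, numLeavesList_append, numLeavesList]
    omega
  | child c l r s s' h ih =>
    simp only [numLeaves, numLeavesList_append, numLeavesList, ih]

theorem Step.numNodes_lt [PartialOrder Q] {s t : LTree Q} (h : Step s t) :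
    t.numNodes < s.numNodes := by
  induction h with
  | root a b l us r h =>
    simp only [numNodes, numNodesList_append, numNodesList]
    omega
  | child c l r s s' h ih =>
    simp only [numNodes, numNodesList_append, numNodesList]
    omega

theorem Step.isSchroder [PartialOrder Q] {s t : LTree Q} (h : Step s t) (hs : IsSchroder s) :
    IsSchroder t := by
  induction h with
  | root a b l us r h =>
    simp only [isSchroder_node, List.forall_mem_append, List.forall_mem_cons,
      List.length_append, List.length_cons] at hs ⊢
    obtain ⟨-, h₁, ⟨h₂, h₃⟩, h₄⟩ := hs
    exact ⟨by omega, ⟨h₁, h₃⟩, h₄⟩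
  | child c l r s s' h ih =>
    simp only [isSchroder_node, List.forall_mem_append, List.forall_mem_cons,
      List.length_append, List.length_cons] at hs ⊢
    exact ⟨hs.1, hs.2.1, ih hs.2.2.1, hs.2.2.2⟩

mutual
theorem isAlternating_of_forall_not_step [PartialOrder Q] : ∀ (t : LTree Q),
    (∀ t', ¬ Step t t') → IsAlternating t
  | .leaf, _ => .leaf
  | .node a ts, h => by
    refine .node a ts ?_ (isAlternating_of_forall_not_step_list ts ?_)
    · intro b us hb
      obtain ⟨l, r, rfl⟩ := List.append_of_mem hb
      exact ⟨fun hab => h _ (.root b a l us r (.inr hab)),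
        fun hba => h _ (.root b a l us r (.inl hba))⟩
    · intro t ht t' htt'
      obtain ⟨l, r, rfl⟩ := List.append_of_mem ht
      exact h _ (.child a l r t t' htt')
theorem isAlternating_of_forall_not_step_list [PartialOrder Q] : ∀ (ts : List (LTree Q)),
    (∀ t ∈ ts, ∀ t', ¬ Step t t') → ∀ t ∈ ts, IsAlternating t
  | [], _ => by simp
  | t :: ts, h => by
    rw [List.forall_mem_cons] at h ⊢
    exact ⟨isAlternating_of_forall_not_step t h.1, isAlternating_of_forall_not_step_list ts h.2⟩
end

end LTree

/-- `Q`-Schröder trees with `n` leaves. -/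
abbrev SchroderTree (Q : Type*) (n : ℕ) : Type _ :=
  {t : LTree Q // t.IsSchroder ∧ t.numLeaves = n}

namespace SchroderTree

variable {Q : Type*}

/-- The one-step rewriting relation on `Q`-Schröder trees with `n` leaves (rewriting preserves the
number of leaves). -/
def Step [PartialOrder Q] {n : ℕ} (s t : SchroderTree Q n) : Prop :=
  LTree.Step s.1 t.1

def IsAlternating [PartialOrder Q] {n : ℕ} (t : SchroderTree Q n) : Prop :=
  t.1.IsAlternating

/-- The tree consisting of one leaf. -/
def leaf : SchroderTree Q 1 :=
  ⟨.leaf, .leaf, rfl⟩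

def graft {n m p : ℕ} (i : Fin n) (h : n + m = p + 1) (s : SchroderTree Q n)
    (t : SchroderTree Q m) : SchroderTree Q p :=
  ⟨LTree.graft t.1 s.1 i, t.2.1.graft s.1 i s.2.1, by
    have h₁ := LTree.numLeaves_graft t.1 s.1 i (by rw [s.2.2]; exact i.2)
    have h₂ := s.2.2
    have h₃ := t.2.2
    omega⟩

theorem exists_normalForm [PartialOrder Q] {n : ℕ} (t : SchroderTree Q n) :
    ∃ u : SchroderTree Q n, Relation.ReflTransGen Step t u ∧ IsNormalForm Step u := by
  induction hk : t.1.numNodes using Nat.strong_induction_on generalizing t with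
  | _ k ih =>
    by_cases ht : IsNormalForm Step t
    · exact ⟨t, .refl, ht⟩
    · simp only [IsNormalForm, not_forall, not_not] at ht
      obtain ⟨t', ht'⟩ := ht
      obtain ⟨u, hu, hn⟩ := ih _ (hk ▸ LTree.Step.numNodes_lt ht') t' rfl
      exact ⟨u, .head ht' hu, hn⟩

/-- A normal form of a tree for the rewriting relation. -/
noncomputable def normalForm [PartialOrder Q] {n : ℕ} (t : SchroderTree Q n) : SchroderTree Q n :=
  (exists_normalForm t).choose

theorem normalForm_spec [PartialOrder Q] {n : ℕ} (t : SchroderTree Q n) :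
    Relation.ReflTransGen Step t t.normalForm ∧ IsNormalForm Step t.normalForm :=
  (exists_normalForm t).choose_spec

theorem isAlternating_normalForm [PartialOrder Q] {n : ℕ} (t : SchroderTree Q n) :
    t.normalForm.IsAlternating :=
  LTree.isAlternating_of_forall_not_step _ fun t' ht' =>
    t.normalForm_spec.2 ⟨t', ht'.isSchroder t.normalForm.2.1,
      ht'.numLeaves_eq.trans t.normalForm.2.2⟩ ht'

end SchroderTree

/-- `Q`-alternating Schröder trees with `n` leaves. -/
abbrev AltSchroderTree (Q : Type*) [PartialOrder Q] (n : ℕ) : Type _ :=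
  {t : SchroderTree Q n // t.IsAlternating}

/-- Composition of `Q`-alternating Schröder trees: the normal form of the grafting. -/
noncomputable def AltSchroderTree.comp {Q : Type*} [PartialOrder Q] {n m p : ℕ} (i : Fin n)
    (h : n + m = p + 1) (s : AltSchroderTree Q n) (t : AltSchroderTree Q m) :
    AltSchroderTree Q p :=
  ⟨(SchroderTree.graft i h s.1 t.1).normalForm, SchroderTree.isAlternating_normalForm _⟩

/-- `ASchr(Q)`: the linear span of the `Q`-alternating Schröder trees, graded by the number of
leaves, with the bilinear extension of the composition of trees. -/
noncomputable def ASchrOperad (K : Type*) [Field K] (Q : Type*) [PartialOrder Q] :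
    OperadData K where
  space n := AltSchroderTree Q n →₀ K
  comp i h := bilinExt K (AltSchroderTree.comp i h)
  one := Finsupp.single ⟨SchroderTree.leaf, .leaf⟩ 1

/-! ### Minima of comparable elements -/

section UpMin

variable {Q : Type*} [PartialOrder Q]

-- Each step removes one internal node, so rewriting terminates, and by Newman's lemma local
-- confluence is enough. If two children of a node labeled `c` have labels `a` and `b` comparable
-- with `c`, absorbing the first must not prevent absorbing the second: `min(a, c)` has to be
-- comparable with `b`. The only doubtful case is `a, b ≤ c`, and there the forest condition is
-- exactly what is needed. Since the minimum is associative and commutative along such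
-- comparabilities, both orders end with the same label (`Move.disjoint`, `Move.upMin`,
-- `join_of_step`).
--
-- For the isomorphism, a binary tree is sent to its normal form as a Schröder tree. Steps are
-- compatible with grafting on both sides, so by uniqueness of normal forms this respects
-- composition (`SyntaxTree.toAlt_graft`). It kills the relations because both sides of each one
-- rewrite to the same corolla. The inverse expands every node into a right comb with constant
-- label. One composite is the identity because a comb expansion rewrites back to its tree. The
-- other is the identity because each rewriting step becomes, after expansion, a consequence of the
-- relations (`AsRel.comb_absorb`, `AsRel.of_step`). Having an explicit inverse avoids any dimension
-- count, and the operad axioms for `ASchr(Q)` are transported from `As(Q)`.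

theorem upMin_eq_left {a b : Q} (h : a ≤ b) : upMin a b = a := if_pos h

theorem upMin_eq_right {a b : Q} (h : b ≤ a) : upMin a b = b := by
  unfold upMin
  split_ifs with h'
  · exact le_antisymm h' h
  · rfl

theorem upMin_self (a : Q) : upMin a a = a := upMin_eq_left le_rfl

theorem upMin_comm {a b : Q} (h : a ≤ b ∨ b ≤ a) : upMin a b = upMin b a := by
  rcases h with h | h
  · rw [upMin_eq_left h, upMin_eq_right h]
  · rw [upMin_eq_left h, upMin_eq_right h]

theorem IsForestPoset.comparable (hQ : IsForestPoset Q) {a b c : Q} (ha : a ≤ c) (hb : b ≤ c) :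
    a ≤ b ∨ b ≤ a := by
  by_contra! h
  rcases ha.eq_or_lt with rfl | ha
  · exact h.2 hb
  rcases hb.eq_or_lt with rfl | hb
  · exact h.1 ha.le
  exact hQ ⟨a, b, c, ha, hb, h.1, h.2⟩

/-- The case `a ≤ b`, `c ≤ b` is where the forest condition acts; the others follow by transitivity
or directly. The confluence proof uses the forest condition only through this lemma. -/
theorem IsForestPoset.upMin_comparable (hQ : IsForestPoset Q) {a b c : Q}
    (hab : a ≤ b ∨ b ≤ a) (hbc : b ≤ c ∨ c ≤ b) : upMin a b ≤ c ∨ c ≤ upMin a b := by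
  rcases hab with hab | hab
  · rw [upMin_eq_left hab]
    rcases hbc with hbc | hbc
    · exact .inl (hab.trans hbc)
    · exact hQ.comparable hab hbc
  · rwa [upMin_eq_right hab]

/-- No forest condition is needed: when `a` and `c` both lie below `b`, both sides reduce to the
same term `upMin a c`, whether or not that is a genuine minimum. -/
theorem upMin_assoc {a b c : Q}
    (hab : a ≤ b ∨ b ≤ a) (hbc : b ≤ c ∨ c ≤ b) :
    upMin (upMin a b) c = upMin a (upMin b c) := by
  rcases hab with hab | hab <;> rcases hbc with hbc | hbc
  · rw [upMin_eq_left hab, upMin_eq_left hbc, upMin_eq_left hab, upMin_eq_left (hab.trans hbc)]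
  · rw [upMin_eq_left hab, upMin_eq_right hbc]
  · rw [upMin_eq_right hab, upMin_eq_left hbc, upMin_eq_right hab]
  · rw [upMin_eq_right hab, upMin_eq_right hbc, upMin_eq_right (hbc.trans hab)]

end UpMin

/-! ### Confluence -/

/-- Newman's lemma. -/
theorem newman {S : Type*} {r : S → S → Prop} (wf : WellFounded (Function.swap r))
    (hr : ∀ s t u, r s t → r s u → Relation.Join (Relation.ReflTransGen r) t u) :
    IsConfluent r := by
  intro s
  induction s using wf.induction with
  | _ s ih =>
    intro t u ht hu
    rcases ht.cases_head with rfl | ⟨t₁, h₁, ht⟩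
    · exact ⟨u, hu, .refl⟩
    rcases hu.cases_head with rfl | ⟨u₁, h₂, hu⟩
    · exact ⟨t, .refl, .head h₁ ht⟩
    obtain ⟨v, hv₁, hv₂⟩ := hr s t₁ u₁ h₁ h₂
    obtain ⟨w, hw₁, hw₂⟩ := ih t₁ h₁ t v ht hv₁
    obtain ⟨x, hx₁, hx₂⟩ := ih u₁ h₂ u w hu (hv₂.trans hw₂)
    exact ⟨x, hw₁.trans hx₂, hx₁⟩

/-- Used to separate two steps acting at the same child of a node from two steps acting at distinct
children. -/
theorem List.append_cons_eq_append_cons {α : Type*} {x y : α} {l r l' r' : List α}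
    (h : l ++ x :: r = l' ++ y :: r') :
    (l = l' ∧ x = y ∧ r = r') ∨ (∃ m, l' = l ++ x :: m ∧ r = m ++ y :: r') ∨
      ∃ m, l = l' ++ y :: m ∧ r' = m ++ x :: r := by
  rcases List.append_eq_append_iff.1 h with ⟨m, rfl, hm⟩ | ⟨m, rfl, hm⟩
  · cases m with
    | nil => simp_all
    | cons z m => simp_all
  · cases m with
    | nil => simp_all
    | cons z m => simp_all

namespace LTree

variable {Q : Type*}

theorem graftList_append (t : LTree Q) (l r : List (LTree Q)) (i : ℕ) :
    graftList t (l ++ r) i = if i < numLeavesList l then graftList t l i ++ r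
      else l ++ graftList t r (i - numLeavesList l) := by
  induction l generalizing i with
  | nil => simp [numLeavesList]
  | cons s l ih =>
    simp only [List.cons_append, graftList, numLeavesList, ih]
    by_cases h₁ : i < s.numLeaves
    · simp [h₁, Nat.lt_add_right]
    · by_cases h₂ : i - s.numLeaves < numLeavesList l
      · have : i < s.numLeaves + numLeavesList l := by omega
        simp [h₁, h₂, this]
      · have : ¬ i < s.numLeaves + numLeavesList l := by omega
        simp [h₁, h₂, this, Nat.sub_sub]

-- Local confluence

section Rewriting

variable [PartialOrder Q]

/-- `Move c s c' S`: a node labeled by `c` with a child `s` rewrites into the node labeled by `c'`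
where the subtrees `S` replace `s`. -/
inductive Move (c : Q) : LTree Q → Q → List (LTree Q) → Prop
  | absorb (a : Q) (us : List (LTree Q)) : a ≤ c ∨ c ≤ a → Move c (.node a us) (upMin a c) us
  | inner (s s' : LTree Q) : Step s s' → Move c s c [s']

theorem Move.step {c c' : Q} {s : LTree Q} {S : List (LTree Q)} (h : Move c s c' S)
    (l r : List (LTree Q)) : Step (.node c (l ++ s :: r)) (.node c' (l ++ S ++ r)) := by
  cases h with
  | absorb a _ h => exact .root a c l _ r h
  | inner s s' h => simpa using Step.child c l r s s' h

theorem Step.exists_move {c : Q} {ts : List (LTree Q)} {u : LTree Q} (h : Step (.node c ts) u) :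
    ∃ l s r c' S, ts = l ++ s :: r ∧ Move c s c' S ∧ u = .node c' (l ++ S ++ r) := by
  cases h with
  | root a b l us r h => exact ⟨l, _, r, _, _, rfl, .absorb a _ h, rfl⟩
  | child c l r s s' h => exact ⟨l, s, r, c, [s'], rfl, .inner s s' h, by simp⟩

theorem not_step_leaf (t : LTree Q) : ¬ Step .leaf t := nofun

/-- Moves at distinct children interact only through the label of the parent. Two absorptions give
the minimum of the three labels in either order, and the forest condition keeps the second one
possible after the first. -/
theorem Move.disjoint (hQ : IsForestPoset Q) {c c₁ c₂ : Q} {s t : LTree Q}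
    {S T : List (LTree Q)} (hs : Move c s c₁ S) (ht : Move c t c₂ T) :
    ∃ d, Move c₁ t d T ∧ Move c₂ s d S := by
  cases hs with
  | absorb a _ ha =>
    cases ht with
    | absorb b _ hb =>
      refine ⟨upMin b (upMin a c), .absorb b _ (hQ.upMin_comparable ha hb.symm).symm, ?_⟩
      have h : upMin b (upMin a c) = upMin a (upMin b c) := by
        rw [upMin_comm ha, ← upMin_assoc hb ha.symm,
          upMin_comm (hQ.upMin_comparable hb ha.symm)]
      rw [h]
      exact .absorb a _ (hQ.upMin_comparable hb ha.symm).symm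
    | inner t t' ht => exact ⟨_, .inner t t' ht, .absorb a _ ha⟩
  | inner s s' hs =>
    cases ht with
    | absorb b _ hb => exact ⟨_, .absorb b _ hb, .inner s s' hs⟩
    | inner t t' ht => exact ⟨c, .inner t t' ht, .inner s s' hs⟩

/-- A move at a node labeled `a` survives the absorption of that node by a parent labeled `c`, and
the final labels agree by associativity of the minimum. -/
theorem Move.upMin (hQ : IsForestPoset Q) {a a' c : Q} {s : LTree Q} {S : List (LTree Q)}
    (h : Move a s a' S) (hac : a ≤ c ∨ c ≤ a) :
    (a' ≤ c ∨ c ≤ a') ∧ Move (upMin a c) s (upMin a' c) S := by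
  cases h with
  | absorb b _ hb =>
    refine ⟨hQ.upMin_comparable hb hac, ?_⟩
    rw [upMin_assoc hb hac]
    refine .absorb b _ ?_
    rw [upMin_comm hac]
    exact (hQ.upMin_comparable hac.symm hb.symm).symm
  | inner s s' h => exact ⟨hac, .inner s s' h⟩

theorem reflTransGen_child (c : Q) (l r : List (LTree Q)) {s s' : LTree Q}
    (h : Relation.ReflTransGen Step s s') :
    Relation.ReflTransGen Step (.node c (l ++ s :: r)) (.node c (l ++ s' :: r)) :=
  h.lift (fun s => LTree.node c (l ++ s :: r)) fun s s' h => .child c l r s s' h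

/-- The critical pair where a node is absorbed or first rewritten. One step closes it on each side:
the surviving move after the absorption, or the absorption of the rewritten node, possibly with a
new label. -/
theorem join_absorb_inner (hQ : IsForestPoset Q) {a c : Q} (l r us : List (LTree Q))
    (hac : a ≤ c ∨ c ≤ a) {s : LTree Q} (h : Step (.node a us) s) :
    Relation.Join (Relation.ReflTransGen Step) (.node (upMin a c) (l ++ us ++ r))
      (.node c (l ++ s :: r)) := by
  obtain ⟨l', x, r', a', X, rfl, hx, rfl⟩ := h.exists_move
  obtain ⟨hc, hm⟩ := hx.upMin hQ hac
  refine ⟨.node (upMin a' c) (l ++ (l' ++ X ++ r') ++ r), .single ?_, .single (.root a' c l _ r hc)⟩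
  simpa using hm.step (l ++ l') (r' ++ r)

theorem join_of_step (hQ : IsForestPoset Q) {s t u : LTree Q} (ht : Step s t) (hu : Step s u) :
    Relation.Join (Relation.ReflTransGen Step) t u := by
  induction hk : s.numNodes using Nat.strong_induction_on generalizing s t u with
  | _ k ih =>
    cases s with
    | leaf => exact absurd ht (not_step_leaf _)
    | node c ts =>
      obtain ⟨l, x, r, c₁, X, rfl, hx, rfl⟩ := ht.exists_move
      obtain ⟨l', y, r', c₂, Y, heq, hy, rfl⟩ := hu.exists_move
      rcases List.append_cons_eq_append_cons heq with ⟨rfl, rfl, rfl⟩ | ⟨m, rfl, rfl⟩ | ⟨m, rfl, rfl⟩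
      · cases hx with
        | absorb a _ ha =>
          cases hy with
          | absorb => exact ⟨_, .refl, .refl⟩
          | inner y y' hy => simpa using join_absorb_inner hQ l r _ ha hy
        | inner x x' hx =>
          cases hy with
          | absorb a _ ha =>
            obtain ⟨v, h₁, h₂⟩ := join_absorb_inner hQ l r _ ha hx
            exact ⟨v, by simpa using h₂, h₁⟩
          -- Both steps take place inside the same child, which has fewer nodes, so induction
          -- applies.
          | inner y y' hy =>
            obtain ⟨v, h₁, h₂⟩ := ih x.numNodes
              (by simp only [← hk, numNodes, numNodesList_append, numNodesList]; omega) hx hy rfl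
            exact ⟨.node c (l ++ v :: r), by simpa using reflTransGen_child c l r h₁,
              by simpa using reflTransGen_child c l r h₂⟩
      · obtain ⟨d, h₁, h₂⟩ := hx.disjoint hQ hy
        refine ⟨.node d (l ++ X ++ m ++ Y ++ r'), .single ?_, .single ?_⟩
        · simpa using h₁.step (l ++ X ++ m) r'
        · simpa using h₂.step l (m ++ Y ++ r')
      · obtain ⟨d, h₁, h₂⟩ := hx.disjoint hQ hy
        refine ⟨.node d (l' ++ Y ++ m ++ X ++ r), .single ?_, .single ?_⟩
        · simpa using h₁.step l' (m ++ X ++ r)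
        · simpa using h₂.step (l' ++ Y ++ m) r

theorem isConfluent_step (hQ : IsForestPoset Q) : IsConfluent (Step (Q := Q)) :=
  newman (Subrelation.wf (fun {_ _} h => Step.numNodes_lt h)
    (measure (numNodes (Q := Q))).wf) fun _ _ _ => join_of_step hQ

theorem IsAlternating.not_step {s : LTree Q} (hs : s.IsAlternating) (t : LTree Q) :
    ¬ Step s t := by
  intro h
  induction h with
  | root a b l us r h =>
    cases hs with
    | node _ _ h₁ h₂ =>
      have := h₁ a us (by simp)
      exact h.elim this.2 this.1
  | child c l r s s' h ih =>
    cases hs with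
    | node _ _ h₁ h₂ => exact ih (h₂ s (by simp))

-- Compatibility of rewriting with grafting

theorem Step.graft_left (t : LTree Q) {s s' : LTree Q} (h : Step s s') (i : ℕ) :
    Step (graft t s i) (graft t s' i) := by
  induction h generalizing i with
  | root a b l us r h =>
    simp only [graft, List.append_assoc, graftList_append, graftList, numLeaves]
    -- The leaf lies in `l`, `us` or `r`. If it lies in `l`, the second test is irrelevant, so the
    -- first two of the four branches coincide.
    by_cases h₁ : i < numLeavesList l <;> by_cases h₂ : i - numLeavesList l < numLeavesList us <;>
      simp only [h₁, h₂, if_true, if_false]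
    · simpa using Step.root a b (graftList t l i) us r h
    · simpa using Step.root a b (graftList t l i) us r h
    · simpa using Step.root a b l (graftList t us (i - numLeavesList l)) r h
    · simpa using Step.root a b l us
        (graftList t r (i - numLeavesList l - numLeavesList us)) h
  | child c l r s s' h ih =>
    simp only [graft, graftList_append, graftList, h.numLeaves_eq]
    split_ifs
    · exact .child c _ _ s s' h
    · exact .child c _ _ _ _ (ih _)
    · exact .child c _ _ s s' h

theorem Step.graft_right {t t' : LTree Q} (h : Step t t') (s : LTree Q) (i : ℕ)
    (hi : i < s.numLeaves) : Step (graft t s i) (graft t' s i) := by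
  induction hk : sizeOf s using Nat.strong_induction_on generalizing s i with
  | _ k ih =>
    cases s with
    | leaf => simpa [graft] using h
    | node a ss =>
      -- The child that receives the graft and the position in it do not depend on the grafted tree,
      -- so `t` and `t'` land in the same place. The bound on `i` matters: beyond the last leaf
      -- nothing is grafted.
      have key : ∀ (ss : List (LTree Q)) (i : ℕ), i < numLeavesList ss →
          ∃ l s r j, j < s.numLeaves ∧ ss = l ++ s :: r ∧
            ∀ t : LTree Q, graftList t ss i = l ++ graft t s j :: r := by
        intro ss
        induction ss with
        | nil => intro i hi; simp [numLeavesList] at hi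
        | cons s ss ih' =>
          intro i hi
          by_cases his : i < s.numLeaves
          · exact ⟨[], s, ss, i, his, rfl, fun t => by simp [graftList, his]⟩
          · simp only [numLeavesList] at hi
            obtain ⟨l, s', r, j, hj, rfl, h⟩ := ih' (i - s.numLeaves) (by omega)
            exact ⟨s :: l, s', r, j, hj, rfl, fun t => by simp [graftList, his, h]⟩
      obtain ⟨l, s, r, j, hj, rfl, hg⟩ := key ss i (by simpa [numLeaves] using hi)
      rw [graft, graft, hg, hg]
      refine .child a l r _ _ (ih (sizeOf s) ?_ s j hj rfl)
      have : sizeOf s < sizeOf (l ++ s :: r) := List.sizeOf_lt_of_mem (by simp)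
      rw [← hk, LTree.node.sizeOf_spec]
      omega

end Rewriting

/-! ### Binary trees and Schröder trees -/

/-- A binary tree, seen as a Schröder tree. -/
def ofBinary : BinaryTree Q → LTree Q
  | .nil => .leaf
  | .node a l r => .node a [ofBinary l, ofBinary r]

@[simp] theorem numLeaves_ofBinary (t : BinaryTree Q) : (ofBinary t).numLeaves = t.numLeaves := by
  induction t with
  | nil => simp [ofBinary, numLeaves]
  | node a l r hl hr => simp [ofBinary, numLeaves, numLeavesList, BinaryTree.numLeaves, hl, hr]

theorem isSchroder_ofBinary (t : BinaryTree Q) : (ofBinary t).IsSchroder := by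
  induction t with
  | nil => exact .leaf
  | node a l r hl hr => simp [ofBinary, isSchroder_node, hl, hr]

theorem ofBinary_graft (t s : BinaryTree Q) (i : ℕ) (hi : i < s.numLeaves) :
    ofBinary (BinaryTree.graft t s i) = graft (ofBinary t) (ofBinary s) i := by
  induction s generalizing i with
  | nil => simp [ofBinary, BinaryTree.graft, graft]
  | node a l r hl hr =>
    simp only [BinaryTree.numLeaves] at hi
    by_cases h : i < l.numLeaves
    · simp [BinaryTree.graft, ofBinary, graft, graftList, h, hl i h]
    · have h' : i - l.numLeaves < r.numLeaves := by omega
      simp [BinaryTree.graft, ofBinary, graft, graftList, h, h', hr _ h']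

/-- The right comb whose nodes are labeled by `a`, with the given subtrees. -/
def comb (a : Q) : List (BinaryTree Q) → BinaryTree Q
  | [] => .nil
  | [x] => x
  | x :: y :: l => .node a x (comb a (y :: l))

theorem comb_cons (a : Q) (x : BinaryTree Q) {l : List (BinaryTree Q)} (hl : l ≠ []) :
    comb a (x :: l) = .node a x (comb a l) := by
  cases l with
  | nil => exact absurd rfl hl
  | cons y l => rfl

theorem comb_append (a : Q) (l : List (BinaryTree Q)) {r : List (BinaryTree Q)} (hr : r ≠ []) :
    comb a (l ++ r) = l.foldr (.node a) (comb a r) := by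
  induction l with
  | nil => rfl
  | cons x l ih => rw [List.cons_append, comb_cons a x (by simp [hr]), ih, List.foldr_cons]

mutual
/-- The binary tree obtained by expanding each node into a right comb. -/
def toBinary : LTree Q → BinaryTree Q
  | .leaf => .nil
  | .node a ts => comb a (toBinaryList ts)
/-- The expansions of the members of a list of trees. -/
def toBinaryList : List (LTree Q) → List (BinaryTree Q)
  | [] => []
  | t :: ts => toBinary t :: toBinaryList ts
end

theorem toBinaryList_eq_map (ts : List (LTree Q)) : toBinaryList ts = ts.map toBinary := by
  induction ts with
  | nil => rfl
  | cons t ts ih => rw [toBinaryList, ih, List.map_cons]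

theorem toBinary_ofBinary (t : BinaryTree Q) : toBinary (ofBinary t) = t := by
  induction t with
  | nil => rfl
  | node a l r hl hr => simp [ofBinary, toBinary, toBinaryList, comb, hl, hr]

-- Rewriting a comb expansion back to its tree

section

variable [PartialOrder Q]

/-- The right edges are contracted from the bottom up; the label stays `a` since `min(a, a) = a`. -/
theorem reflTransGen_ofBinary_comb (a : Q) (x y : BinaryTree Q) (l : List (BinaryTree Q)) :
    Relation.ReflTransGen Step (ofBinary (comb a (x :: y :: l)))
      (.node a ((x :: y :: l).map ofBinary)) := by
  induction l generalizing x y with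
  | nil => exact .refl
  | cons z l ih =>
    refine (reflTransGen_child a [ofBinary x] [] (ih y z)).tail ?_
    have := Step.root a a [ofBinary x] ((y :: z :: l).map ofBinary) [] (.inl le_rfl)
    rw [upMin_self] at this
    simpa using this

theorem reflTransGen_node (a : Q) {ts : List (LTree Q)} {f : LTree Q → LTree Q}
    (h : ∀ t ∈ ts, Relation.ReflTransGen Step (f t) t) (l : List (LTree Q)) :
    Relation.ReflTransGen Step (.node a (l ++ ts.map f)) (.node a (l ++ ts)) := by
  induction ts generalizing l with
  | nil => simpa using Relation.ReflTransGen.refl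
  | cons t ts ih =>
    rw [List.forall_mem_cons] at h
    refine (reflTransGen_child a l (ts.map f) h.1).trans ?_
    simpa using ih h.2 (l ++ [t])

/-- The Schröder condition is essential: the comb on fewer than two subtrees has no node of its own,
so the expansion would lose the label. -/
theorem reflTransGen_ofBinary_toBinary {t : LTree Q} (ht : t.IsSchroder) :
    Relation.ReflTransGen Step (ofBinary (toBinary t)) t := by
  induction ht with
  | leaf => exact .refl
  | node a ts h₁ h₂ ih =>
    refine .trans ?_ (reflTransGen_node a (f := fun t => ofBinary (toBinary t)) ih [])
    match ts, h₁ with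
    | x :: y :: l, _ =>
      simpa [toBinary, toBinaryList, toBinaryList_eq_map, Function.comp_def] using
        reflTransGen_ofBinary_comb a (toBinary x) (toBinary y) (l.map toBinary)

theorem reflTransGen_numLeaves {s t : LTree Q} (h : Relation.ReflTransGen Step s t) :
    t.numLeaves = s.numLeaves := by
  induction h with
  | refl => rfl
  | tail _ h ih => exact h.numLeaves_eq.trans ih

theorem numLeaves_toBinary {t : LTree Q} (ht : t.IsSchroder) :
    (toBinary t).numLeaves = t.numLeaves := by
  rw [← numLeaves_ofBinary, reflTransGen_numLeaves (reflTransGen_ofBinary_toBinary ht)]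

end

end LTree

/-! ### The congruence on binary trees generated by the relations of `As(Q)` -/

section AsRel

variable {Q : Type*} [PartialOrder Q]

/-- The congruence on binary trees generated by the relations of `As(Q)`. -/
inductive AsRel : BinaryTree Q → BinaryTree Q → Prop
  | refl (t) : AsRel t t
  | symm {s t} : AsRel s t → AsRel t s
  | trans {s t u} : AsRel s t → AsRel t u → AsRel s u
  | left (a) {s t} (r) : AsRel s t → AsRel (.node a s r) (.node a t r)
  | right (a) (l) {s t} : AsRel s t → AsRel (.node a l s) (.node a l t)
  | rotate_min {a b} (x y z) : a ≤ b ∨ b ≤ a → AsRel (.node a (.node b x y) z)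
      (.node (upMin a b) x (.node (upMin a b) y z))
  | min_rotate {a b} (x y z) : a ≤ b ∨ b ≤ a →
      AsRel (.node (upMin a b) (.node (upMin a b) x y) z) (.node a x (.node b y z))

namespace AsRel

open LTree

/-- Both right combs are congruent to the left comb labeled by the minimum. Labels can thus be
lowered along a right edge. -/
theorem relabel {a b : Q} (h : a ≤ b ∨ b ≤ a) (x y z : BinaryTree Q) :
    AsRel (.node a x (.node b y z)) (.node (upMin a b) x (.node (upMin a b) y z)) := by
  refine (min_rotate x y z h).symm.trans ?_
  simpa only [upMin_self] using
    rotate_min (a := upMin a b) (b := upMin a b) x y z (.inl le_rfl)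

theorem foldr {a : Q} {s t : BinaryTree Q} (h : AsRel s t) (l : List (BinaryTree Q)) :
    AsRel (l.foldr (BinaryTree.node a) s) (l.foldr (BinaryTree.node a) t) := by
  induction l with
  | nil => exact h
  | cons x l ih => exact ih.right a x

/-- The small label `m` climbs the right spine one edge at a time by `relabel`. -/
theorem foldr_node {m b : Q} (h : m ≤ b) (x z : BinaryTree Q) (l : List (BinaryTree Q)) :
    AsRel (l.foldr (BinaryTree.node b) (.node m x z)) (l.foldr (BinaryTree.node m) (.node m x z)) := by
  induction l with
  | nil => exact .refl _
  | cons y l ih =>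
    refine (ih.right b y).trans ?_
    obtain ⟨u, v, huv⟩ : ∃ u v, l.foldr (BinaryTree.node m) (.node m x z) = BinaryTree.node m u v := by
      cases l with
      | nil => exact ⟨_, _, rfl⟩
      | cons u l => exact ⟨_, _, rfl⟩
    rw [List.foldr_cons, huv]
    simpa only [upMin_eq_right h] using relabel (.inr h) y u v

/-- The converse propagation: `m` descends along the spine. -/
theorem node_comb {m a : Q} (h : m ≤ a) (x : BinaryTree Q) (l : List (BinaryTree Q)) :
    AsRel (.node m x (comb a l)) (.node m x (comb m l)) := by
  induction l generalizing x with
  | nil => exact .refl _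
  | cons y l ih =>
    cases l with
    | nil => exact .refl _
    | cons z l =>
      refine .trans ?_ ((ih y).right m x)
      simpa only [upMin_eq_left h, comb] using relabel (.inl h) x y (comb a (z :: l))

/-- Since `l` is nonempty, a node labeled `m` sits just above the comb, and `m` descends from it. -/
theorem foldr_comb {m a : Q} (h : m ≤ a) {l : List (BinaryTree Q)} (hl : l ≠ [])
    (r : List (BinaryTree Q)) :
    AsRel (l.foldr (BinaryTree.node m) (comb a r)) (l.foldr (BinaryTree.node m) (comb m r)) := by
  obtain ⟨l, x, rfl⟩ := List.eq_nil_or_concat l |>.resolve_left hl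
  simpa [List.foldr_append] using (node_comb h x r).foldr l

/-- Each rotation moves one subtree of the left comb onto the spine labeled `m`. -/
theorem comb_node {m a : Q} (h : m ≤ a) {l : List (BinaryTree Q)} (hl : l ≠ [])
    (z : BinaryTree Q) : AsRel (.node m (comb a l) z) (l.foldr (BinaryTree.node m) z) := by
  induction l with
  | nil => exact absurd rfl hl
  | cons x l ih =>
    cases l with
    | nil => exact .refl _
    | cons y l =>
      refine .trans ?_ ((ih (by simp)).right m x)
      simpa only [upMin_eq_left h, comb] using rotate_min x (comb a (y :: l)) z (.inl h)

/-- The image of a root step under expansion. Some sibling is required: if `l` and `r` are both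
empty, the left side is just `comb a us` and the label `b` has disappeared. -/
theorem comb_absorb {a b : Q} (h : a ≤ b ∨ b ≤ a) (l r : List (BinaryTree Q))
    {us : List (BinaryTree Q)} (hus : 2 ≤ us.length) (hlr : l ≠ [] ∨ r ≠ []) :
    AsRel (comb b (l ++ comb a us :: r)) (comb (upMin a b) (l ++ us ++ r)) := by
  have ha : upMin a b ≤ a := by
    rcases h with h | h
    · rw [upMin_eq_left h]
    · rwa [upMin_eq_right h]
  have hb : upMin a b ≤ b := by
    rcases h with h | h
    · rwa [upMin_eq_left h]
    · rw [upMin_eq_right h]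
  match us, hus with
  | u :: v :: us, _ =>
    rw [comb_append b l (by simp), List.append_assoc, comb_append _ l (by simp)]
    -- If the absorbed child is last, its comb hangs on the right of a node labeled `b`, so
    -- relabeling is enough. Otherwise it hangs on the left and has to be rotated. In both cases a
    -- node labeled by the minimum appears on the spine, and `foldr_node` carries this label up
    -- through `l`.
    by_cases hr : r = []
    · subst hr
      have hl : l ≠ [] := by simpa using hlr
      obtain ⟨l, x, rfl⟩ := List.eq_nil_or_concat l |>.resolve_left hl
      simp only [List.concat_eq_append, List.foldr_append, List.foldr_cons, List.foldr_nil,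
        List.append_nil]
      refine .trans (foldr ?_ l) (foldr_node hb _ _ l)
      have h₁ := relabel h.symm x u (comb a (v :: us))
      rw [← upMin_comm h] at h₁
      exact h₁.trans ((node_comb ha u (v :: us)).right _ x)
    · rw [comb_cons b _ hr, comb_append _ _ hr]
      refine .trans (foldr ?_ l) (foldr_node hb _ _ l)
      have h₁ := rotate_min u (comb a (v :: us)) (comb b r) h.symm
      rw [← upMin_comm h] at h₁
      exact h₁.trans (((comb_node ha (by simp) _).trans (foldr_comb hb (by simp) r)).right _ u)

theorem comb_congr (a : Q) {s t : BinaryTree Q} (h : AsRel s t) (l r : List (BinaryTree Q)) :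
    AsRel (comb a (l ++ s :: r)) (comb a (l ++ t :: r)) := by
  rw [comb_append a l (by simp), comb_append a l (by simp)]
  refine foldr ?_ l
  cases r with
  | nil => exact h
  | cons x r => exact h.left a _

theorem of_step {s t : LTree Q} (h : Step s t) (hs : s.IsSchroder) :
    AsRel (toBinary s) (toBinary t) := by
  induction h with
  | root a b l us r h =>
    simp only [isSchroder_node, List.forall_mem_append, List.forall_mem_cons,
      List.length_append, List.length_cons] at hs
    simp only [toBinary, toBinaryList_eq_map, List.map_append, List.map_cons]
    refine comb_absorb h _ _ (by simpa using hs.2.2.1.1) ?_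
    -- With `l` and `r` empty the node would have a single child.
    by_contra! hlr
    simp only [List.map_eq_nil_iff] at hlr
    simp [hlr] at hs
  | child c l r s s' h ih =>
    simp only [isSchroder_node, List.forall_mem_append, List.forall_mem_cons] at hs
    simp only [toBinary, toBinaryList_eq_map, List.map_append, List.map_cons]
    exact comb_congr c (ih hs.2.2.1) _ _

theorem of_reflTransGen_step {s t : LTree Q} (h : Relation.ReflTransGen Step s t)
    (hs : s.IsSchroder) : AsRel (toBinary s) (toBinary t) := by
  induction h using Relation.ReflTransGen.head_induction_on with
  | refl => exact .refl _
  | head h _ ih => exact (of_step h hs).trans (ih (h.isSchroder hs))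

theorem numLeaves_eq {s t : BinaryTree Q} (h : AsRel s t) : s.numLeaves = t.numLeaves := by
  induction h with
  | refl => rfl
  | symm _ ih => exact ih.symm
  | trans _ _ ih₁ ih₂ => exact ih₁.trans ih₂
  | left _ _ _ ih => simp only [BinaryTree.numLeaves, ih]
  | right _ _ _ ih => simp only [BinaryTree.numLeaves, ih]
  | rotate_min => simp only [BinaryTree.numLeaves]; omega
  | min_rotate => simp only [BinaryTree.numLeaves]; omega

end AsRel

end AsRel

/-! ### Soundness of the congruence -/

theorem freeOperad_comp_single (K : Type*) [Field K] {Q : Type*} {n m p : ℕ} (i : Fin n) (h : n + m = p + 1) (s : SyntaxTree Q n)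
    (t : SyntaxTree Q m) :
    (freeOperad K Q).comp i h (Finsupp.single s (1 : K)) (Finsupp.single t (1 : K)) =
      Finsupp.single (SyntaxTree.graft i h s t) (1 : K) :=
  bilinExt_single K (SyntaxTree.graft i h) s t

section Soundness

variable (K : Type*) [Field K] {Q : Type*} [PartialOrder Q]

open OperadData

theorem le_idealSpan {K : Type*} [Field K] (O : OperadData K)
    (R : ∀ n, Submodule K (O.space n)) (n : ℕ) : R n ≤ O.idealSpan R n := by
  intro x hx
  refine Submodule.mem_sInf.2 ?_
  rintro J ⟨I, -, hR, rfl⟩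
  exact hR n hx

/-- The class in `As(Q)` of a binary tree. -/
noncomputable def asClass {n : ℕ} (t : BinaryTree Q) (h : t.numLeaves = n) :
    (AsOperad K Q).space n :=
  Submodule.Quotient.mk (p := (freeOperad K Q).idealSpan (asRelations K Q) n)
    (Finsupp.single (⟨t, h⟩ : SyntaxTree Q n) (1 : K))

theorem asOperad_comp_asClass {n m p : ℕ} (i : Fin n) (h : n + m = p + 1) (s t : BinaryTree Q)
    (hs : s.numLeaves = n) (ht : t.numLeaves = m) :
    (AsOperad K Q).comp i h (asClass K s hs) (asClass K t ht) =
      asClass K (BinaryTree.graft t s i) (SyntaxTree.graft i h ⟨s, hs⟩ ⟨t, ht⟩).2 := by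
  refine (quotient_comp_mk _ _ _ i h _ _).trans ?_
  rw [freeOperad_comp_single]
  rfl

/-- Two binary trees have the same class in `As(Q)`. -/
def AsEq (s t : BinaryTree Q) : Prop :=
  ∀ n (hs : s.numLeaves = n), ∃ ht : t.numLeaves = n, asClass K s hs = asClass K t ht

variable {K}

theorem AsEq.graft_left {s s' : BinaryTree Q} (h : AsEq K s s') (t : BinaryTree Q) {i : ℕ}
    (hi : i < s.numLeaves) : AsEq K (BinaryTree.graft t s i) (BinaryTree.graft t s' i) := by
  rintro n hn
  obtain ⟨h, e⟩ := h _ rfl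
  have e₁ := BinaryTree.numLeaves_graft t s i hi
  have e₂ := BinaryTree.numLeaves_graft t s' i (h ▸ hi)
  refine ⟨by omega, ?_⟩
  have c₁ := asOperad_comp_asClass K ⟨i, hi⟩ (show _ = n + 1 by omega) s t rfl rfl
  have c₂ := asOperad_comp_asClass K ⟨i, hi⟩ (show _ = n + 1 by omega) s' t h rfl
  exact c₁.symm.trans ((congrArg (fun x => (AsOperad K Q).comp _ _ x _) e).trans c₂)

theorem AsEq.graft_right {t t' : BinaryTree Q} (h : AsEq K t t') (s : BinaryTree Q) {i : ℕ}
    (hi : i < s.numLeaves) : AsEq K (BinaryTree.graft t s i) (BinaryTree.graft t' s i) := by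
  rintro n hn
  obtain ⟨h, e⟩ := h _ rfl
  have e₁ := BinaryTree.numLeaves_graft t s i hi
  have e₂ := BinaryTree.numLeaves_graft t' s i hi
  refine ⟨by omega, ?_⟩
  have c₁ := asOperad_comp_asClass K ⟨i, hi⟩ (show _ = n + 1 by omega) s t rfl rfl
  have c₂ := asOperad_comp_asClass K ⟨i, hi⟩ (show _ = n + 1 by omega) s t' rfl h
  exact c₁.symm.trans ((congrArg (fun x => (AsOperad K Q).comp _ _ _ x) e).trans c₂)

variable (K)

/-- The syntax tree of the generator `⋆_a`. -/
def corolla {Q : Type*} (a : Q) : SyntaxTree Q 2 := ⟨.node a .nil .nil, rfl⟩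

theorem AsEq.rotate_min {a b : Q} (h : a ≤ b ∨ b ≤ a) :
    AsEq K (.node a (.node b .nil .nil) .nil)
      (.node (upMin a b) .nil (.node (upMin a b) .nil .nil)) := by
  rintro _ rfl
  refine ⟨rfl, (Submodule.Quotient.eq _).2 (le_idealSpan _ _ _ (Submodule.subset_span ?_))⟩
  refine ⟨rfl, a, b, h, .inl ?_⟩
  exact congrArg₂ (· - ·) (freeOperad_comp_single K (n := 2) (m := 2) (p := 3) 0 rfl (corolla a) (corolla b)).symm
    (freeOperad_comp_single K (n := 2) (m := 2) (p := 3) 1 rfl (corolla (upMin a b)) (corolla (upMin a b))).symm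

theorem AsEq.min_rotate {a b : Q} (h : a ≤ b ∨ b ≤ a) :
    AsEq K (.node (upMin a b) (.node (upMin a b) .nil .nil) .nil)
      (.node a .nil (.node b .nil .nil)) := by
  rintro _ rfl
  refine ⟨rfl, (Submodule.Quotient.eq _).2 (le_idealSpan _ _ _ (Submodule.subset_span ?_))⟩
  refine ⟨rfl, a, b, h, .inr ?_⟩
  exact congrArg₂ (· - ·) (freeOperad_comp_single K (n := 2) (m := 2) (p := 3) 0 rfl (corolla (upMin a b)) (corolla (upMin a b))).symm
    (freeOperad_comp_single K (n := 2) (m := 2) (p := 3) 1 rfl (corolla a) (corolla b)).symm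

variable {K}

/-- Extends a relation between trees with leaves as inputs to arbitrary subtrees. Grafting from
right to left leaves the remaining positions unchanged. -/
theorem AsEq.graft_three {s s' : BinaryTree Q} (h : AsEq K s s') (hs : 2 < s.numLeaves)
    (x y z : BinaryTree Q) :
    AsEq K (BinaryTree.graft x (BinaryTree.graft y (BinaryTree.graft z s 2) 1) 0)
      (BinaryTree.graft x (BinaryTree.graft y (BinaryTree.graft z s' 2) 1) 0) := by
  have e₁ := BinaryTree.numLeaves_graft z s 2 (by omega)
  have e₂ := BinaryTree.numLeaves_graft y (BinaryTree.graft z s 2) 1 (by omega)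
  exact ((h.graft_left z hs).graft_left y (by omega)).graft_left x (by omega)

variable (K)

theorem AsRel.asEq {s t : BinaryTree Q} (h : AsRel s t) : AsEq K s t := by
  induction h with
  | refl => exact fun n hs => ⟨hs, rfl⟩
  | @symm s t _ ih =>
    intro n ht
    obtain ⟨h, -⟩ := ih _ rfl
    obtain ⟨_, e⟩ := ih n (h ▸ ht)
    exact ⟨h ▸ ht, e.symm⟩
  | trans _ _ ih₁ ih₂ =>
    intro n hs
    obtain ⟨ht, e₁⟩ := ih₁ n hs
    obtain ⟨hu, e₂⟩ := ih₂ n ht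
    exact ⟨hu, e₁.trans e₂⟩
  | left a r h ih =>
    -- A one-node context around a tree is a grafting on the leaf left free in that node.
    have := ih.graft_right (.node a .nil r) (i := 0) (by simp [BinaryTree.numLeaves])
    simpa [BinaryTree.graft, BinaryTree.numLeaves] using this
  | right a l h ih =>
    have := ih.graft_right (.node a l .nil) (i := l.numLeaves) (by simp [BinaryTree.numLeaves])
    simpa [BinaryTree.graft, BinaryTree.numLeaves] using this
  | rotate_min x y z h =>
    have := (AsEq.rotate_min K h).graft_three (by simp [BinaryTree.numLeaves]) x y z
    simpa [BinaryTree.graft, BinaryTree.numLeaves] using this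
  | min_rotate x y z h =>
    have := (AsEq.min_rotate K h).graft_three (by simp [BinaryTree.numLeaves]) x y z
    simpa [BinaryTree.graft, BinaryTree.numLeaves] using this

end Soundness

/-! ### Spanning families and isomorphisms of operads -/

namespace OperadData

variable {K : Type*} [Field K]

theorem map_comp_of_span {O P : OperadData K} (S : ∀ n, Set (O.space n))
    (hS : ∀ n, Submodule.span K (S n) = ⊤) (f : ∀ n, O.space n →ₗ[K] P.space n)
    {n m p : ℕ} (i : Fin n) (h : n + m = p + 1)
    (hf : ∀ x ∈ S n, ∀ y ∈ S m, f p (O.comp i h x y) = P.comp i h (f n x) (f m y))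
    (x : O.space n) (y : O.space m) : f p (O.comp i h x y) = P.comp i h (f n x) (f m y) := by
  induction (hS n ▸ Submodule.mem_top : x ∈ Submodule.span K (S n)) using
    Submodule.span_induction with
  | zero => simp
  | add x x' _ _ hx hx' => simp [hx, hx']
  | smul c x _ hx => simp [hx]
  | mem x hxS =>
    induction (hS m ▸ Submodule.mem_top : y ∈ Submodule.span K (S m)) using
      Submodule.span_induction with
    | zero => simp
    | add y y' _ _ hy hy' => simp [hy, hy']
    | smul c y _ hy => simp [hy]
    | mem y hyS => exact hf x hxS y hyS

theorem isOperad_of_span (O : OperadData K) (S : ∀ n, Set (O.space n))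
    (hS : ∀ n, Submodule.span K (S n) = ⊤) (arity_zero : S 0 = ∅)
    (comp_assoc : ∀ {n m k p q r : ℕ} (i : Fin n) (j : Fin m)
      (h₁ : n + m = p + 1) (h₂ : p + k = q + 1) (h₃ : m + k = r + 1) (h₄ : n + r = q + 1),
      ∀ x ∈ S n, ∀ y ∈ S m, ∀ z ∈ S k,
      O.comp ⟨i + j, by have := i.2; have := j.2; omega⟩ h₂ (O.comp i h₁ x y) z =
        O.comp i h₄ x (O.comp j h₃ y z))
    (comp_comm : ∀ {n m k p q r : ℕ} (i j : Fin n) (hij : i < j)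
      (h₁ : n + m = p + 1) (h₂ : p + k = q + 1) (h₃ : n + k = r + 1) (h₄ : r + m = q + 1),
      ∀ x ∈ S n, ∀ y ∈ S m, ∀ z ∈ S k,
      O.comp ⟨j + m - 1, by have := j.2; have : i.1 < j.1 := hij; omega⟩ h₂ (O.comp i h₁ x y) z =
        O.comp ⟨i, by have := j.2; have : i.1 < j.1 := hij; omega⟩ h₄ (O.comp j h₃ x z) y)
    (one_comp : ∀ {n : ℕ}, ∀ x ∈ S n, O.comp (0 : Fin 1) (Nat.add_comm 1 n) O.one x = x)
    (comp_one : ∀ {n : ℕ} (i : Fin n), ∀ x ∈ S n, O.comp i rfl x O.one = x) : O.IsOperad where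
  arity_zero := by
    have h := hS 0
    rw [arity_zero, Submodule.span_empty] at h
    exact (Submodule.subsingleton_iff K).1 (subsingleton_of_bot_eq_top h)
  comp_assoc := by
    intro n m k p q r i j h₁ h₂ h₃ h₄ x y z
    induction (hS n ▸ Submodule.mem_top : x ∈ Submodule.span K (S n)) using
      Submodule.span_induction with
    | zero => simp
    | add x x' _ _ hx hx' => simp [hx, hx']
    | smul c x _ hx => simp [hx]
    | mem x hxS =>
      induction (hS m ▸ Submodule.mem_top : y ∈ Submodule.span K (S m)) using
        Submodule.span_induction with
      | zero => simp
      | add y y' _ _ hy hy' => simp [hy, hy']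
      | smul c y _ hy => simp [hy]
      | mem y hyS =>
        induction (hS k ▸ Submodule.mem_top : z ∈ Submodule.span K (S k)) using
          Submodule.span_induction with
        | zero => simp
        | add z z' _ _ hz hz' => simp [hz, hz']
        | smul c z _ hz => simp [hz]
        | mem z hzS => exact comp_assoc i j h₁ h₂ h₃ h₄ x hxS y hyS z hzS
  comp_comm := by
    intro n m k p q r i j hij h₁ h₂ h₃ h₄ x y z
    induction (hS n ▸ Submodule.mem_top : x ∈ Submodule.span K (S n)) using
      Submodule.span_induction with
    | zero => simp
    | add x x' _ _ hx hx' => simp [hx, hx']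
    | smul c x _ hx => simp [hx]
    | mem x hxS =>
      induction (hS m ▸ Submodule.mem_top : y ∈ Submodule.span K (S m)) using
        Submodule.span_induction with
      | zero => simp
      | add y y' _ _ hy hy' => simp [hy, hy']
      | smul c y _ hy => simp [hy]
      | mem y hyS =>
        induction (hS k ▸ Submodule.mem_top : z ∈ Submodule.span K (S k)) using
          Submodule.span_induction with
        | zero => simp
        | add z z' _ _ hz hz' => simp [hz, hz']
        | smul c z _ hz => simp [hz]
        | mem z hzS => exact comp_comm i j hij h₁ h₂ h₃ h₄ x hxS y hyS z hzS
  one_comp := by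
    intro n x
    induction (hS n ▸ Submodule.mem_top : x ∈ Submodule.span K (S n)) using
      Submodule.span_induction with
    | zero => simp
    | add x x' _ _ hx hx' => simp [hx, hx']
    | smul c x _ hx => simp [hx]
    | mem x hxS => exact one_comp x hxS
  comp_one := by
    intro n i x
    induction (hS n ▸ Submodule.mem_top : x ∈ Submodule.span K (S n)) using
      Submodule.span_induction with
    | zero => simp
    | add x x' _ _ hx hx' => simp [hx, hx']
    | smul c x _ hx => simp [hx]
    | mem x hxS => exact comp_one i x hxS

-- Transport along isomorphisms, and kernels of operad maps

theorem Iso.isOperad {O P : OperadData K} (e : O.Iso P) (hO : O.IsOperad) : P.IsOperad where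
  arity_zero := by
    have := hO.arity_zero
    exact (e.equiv 0).symm.toEquiv.subsingleton
  comp_assoc := by
    intro n m k p q r i j h₁ h₂ h₃ h₄ x y z
    obtain ⟨x, rfl⟩ := (e.equiv n).surjective x
    obtain ⟨y, rfl⟩ := (e.equiv m).surjective y
    obtain ⟨z, rfl⟩ := (e.equiv k).surjective z
    simp only [← e.map_comp, hO.comp_assoc i j h₁ h₂ h₃ h₄]
  comp_comm := by
    intro n m k p q r i j hij h₁ h₂ h₃ h₄ x y z
    obtain ⟨x, rfl⟩ := (e.equiv n).surjective x
    obtain ⟨y, rfl⟩ := (e.equiv m).surjective y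
    obtain ⟨z, rfl⟩ := (e.equiv k).surjective z
    simp only [← e.map_comp, hO.comp_comm i j hij h₁ h₂ h₃ h₄]
  one_comp := by
    intro n x
    obtain ⟨x, rfl⟩ := (e.equiv n).surjective x
    rw [← e.map_one, ← e.map_comp, hO.one_comp]
  comp_one := by
    intro n i x
    obtain ⟨x, rfl⟩ := (e.equiv n).surjective x
    rw [← e.map_one, ← e.map_comp, hO.comp_one]

/-- A map of operads that kills `R` kills the ideal generated by `R`. -/
theorem idealSpan_le_ker {O P : OperadData K} (f : ∀ n, O.space n →ₗ[K] P.space n)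
    (hf : ∀ {n m p : ℕ} (i : Fin n) (h : n + m = p + 1) (x : O.space n) (y : O.space m),
      f p (O.comp i h x y) = P.comp i h (f n x) (f m y))
    {R : ∀ n, Submodule K (O.space n)} (hR : ∀ n, R n ≤ LinearMap.ker (f n)) (n : ℕ) :
    O.idealSpan R n ≤ LinearMap.ker (f n) := by
  refine sInf_le ⟨fun n => LinearMap.ker (f n), ⟨?_, ?_⟩, hR, rfl⟩
  · intro n m p i h x y hy
    rw [LinearMap.mem_ker] at hy ⊢
    rw [hf, hy, map_zero]
  · intro n m p i h x hx y
    rw [LinearMap.mem_ker] at hx ⊢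
    rw [hf, hx, map_zero, LinearMap.zero_apply]

end OperadData

/-! ### `As(Q)` is an operad -/

namespace BinaryTree

variable {Q : Type*}

theorem graft_nil (s : BinaryTree Q) (i : ℕ) : graft .nil s i = s := by
  induction s generalizing i with
  | nil => rfl
  | node a l r hl hr => simp [graft, hl, hr]

theorem numLeaves_ne_zero (t : BinaryTree Q) : t.numLeaves ≠ 0 := by
  induction t with
  | nil => simp [numLeaves]
  | node a l r hl hr => simp [numLeaves, hl]

theorem graft_graft (x y z : BinaryTree Q) (i j : ℕ) (hi : i < x.numLeaves)
    (hj : j < y.numLeaves) : graft z (graft y x i) (i + j) = graft (graft z y j) x i := by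
  induction x generalizing i with
  | nil =>
    obtain rfl : i = 0 := by simpa [numLeaves] using hi
    simp [graft]
  | node a l r hl hr =>
    simp only [numLeaves] at hi
    by_cases h : i < l.numLeaves
    · have e := numLeaves_graft y l i h
      have h' : i + j < (graft y l i).numLeaves := by omega
      simp [graft, h, h', hl i h]
    · have h' : ¬ i + j < l.numLeaves := by omega
      have e : i + j - l.numLeaves = i - l.numLeaves + j := by omega
      simp [graft, h, h', e, hr (i - l.numLeaves) (by omega)]

theorem graft_comm (x y z : BinaryTree Q) (i j : ℕ) (hij : i < j) (hj : j < x.numLeaves) :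
    graft z (graft y x i) (j + y.numLeaves - 1) = graft y (graft z x j) i := by
  induction x generalizing i j with
  | nil => simp [numLeaves] at hj; omega
  | node a l r hl hr =>
    simp only [numLeaves] at hj
    -- Every tree has a leaf, so the shift by `y.numLeaves - 1` never moves an index to the left.
    have hy := y.numLeaves_ne_zero
    have hz := z.numLeaves_ne_zero
    by_cases hi' : i < l.numLeaves
    · have e := numLeaves_graft y l i hi'
      by_cases hj' : j < l.numLeaves
      · have e' := numLeaves_graft z l j hj'
        have h₁ : j + y.numLeaves - 1 < (graft y l i).numLeaves := by omega
        have h₂ : i < (graft z l j).numLeaves := by omega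
        simp [graft, hi', hj', h₁, h₂, hl i j hij hj']
      · have h₁ : ¬ j + y.numLeaves - 1 < (graft y l i).numLeaves := by omega
        have h₂ : j + y.numLeaves - 1 - (graft y l i).numLeaves = j - l.numLeaves := by omega
        simp [graft, hi', hj', h₁, h₂]
    · have hj' : ¬ j < l.numLeaves := by omega
      have h₁ : ¬ j + y.numLeaves - 1 < l.numLeaves := by omega
      have h₂ : j + y.numLeaves - 1 - l.numLeaves = j - l.numLeaves + y.numLeaves - 1 := by omega
      simp [graft, hi', hj', h₁, h₂, hr (i - l.numLeaves) (j - l.numLeaves) (by omega) (by omega)]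

end BinaryTree

section AsOperad

variable (K : Type*) [Field K] {Q : Type*}

theorem asClass_congr [PartialOrder Q] {n : ℕ} {s t : BinaryTree Q} (h : s = t)
    (hs : s.numLeaves = n) (ht : t.numLeaves = n) : asClass K s hs = asClass K t ht := by
  subst h
  rfl

theorem asOperad_comp_syntaxTree [PartialOrder Q] {n m p : ℕ} (i : Fin n) (h : n + m = p + 1)
    (s : SyntaxTree Q n) (t : SyntaxTree Q m) :
    (AsOperad K Q).comp i h (asClass K s.1 s.2) (asClass K t.1 t.2) =
      asClass K (SyntaxTree.graft i h s t).1 (SyntaxTree.graft i h s t).2 :=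
  asOperad_comp_asClass K i h s.1 t.1 s.2 t.2

theorem Finsupp.span_range_single_one (A : Type*) :
    Submodule.span K (Set.range fun a : A => Finsupp.single a (1 : K)) = ⊤ := by
  rw [← Finsupp.coe_basisSingleOne]
  exact Module.Basis.span_eq _

variable (Q) [PartialOrder Q]

theorem span_range_asClass (n : ℕ) :
    Submodule.span K (Set.range fun t : SyntaxTree Q n => asClass K t.1 t.2) = ⊤ := by
  have h := congrArg (Submodule.map ((freeOperad K Q).idealSpan (asRelations K Q) n).mkQ)
    (Finsupp.span_range_single_one K (SyntaxTree Q n))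
  refine Eq.trans ?_ (h.trans ((Submodule.map_top _).trans (Submodule.range_mkQ _)))
  refine Eq.trans ?_ (Submodule.map_span _ _).symm
  exact congrArg (Submodule.span K) (Set.range_comp _ _)

theorem isOperad_asOperad : (AsOperad K Q).IsOperad := by
  refine OperadData.isOperad_of_span _
    (fun n => Set.range fun t : SyntaxTree Q n => asClass K t.1 t.2) (span_range_asClass K Q)
    ?_ ?_ ?_ ?_ ?_
  · exact Set.range_eq_empty_iff.2 ⟨fun t => t.1.numLeaves_ne_zero t.2⟩
  · rintro n m k p q r i j h₁ h₂ h₃ h₄ _ ⟨x, rfl⟩ _ ⟨y, rfl⟩ _ ⟨z, rfl⟩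
    have e := BinaryTree.graft_graft x.1 y.1 z.1 i j (x.2.symm ▸ i.2) (y.2.symm ▸ j.2)
    simp only [asOperad_comp_syntaxTree]
    exact asClass_congr K e _ _
  · rintro n m k p q r i j hij h₁ h₂ h₃ h₄ _ ⟨x, rfl⟩ _ ⟨y, rfl⟩ _ ⟨z, rfl⟩
    have e := BinaryTree.graft_comm x.1 y.1 z.1 i j hij (x.2.symm ▸ j.2)
    rw [y.2] at e
    simp only [asOperad_comp_syntaxTree]
    exact asClass_congr K e _ _
  · rintro n _ ⟨x, rfl⟩
    exact asOperad_comp_asClass K (n := 1) 0 (Nat.add_comm 1 n) .nil x.1 rfl x.2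
  · rintro n i _ ⟨x, rfl⟩
    refine (asOperad_comp_asClass K (m := 1) i rfl x.1 .nil x.2 rfl).trans ?_
    exact asClass_congr K (BinaryTree.graft_nil _ _) _ _

end AsOperad

/-! ### Normal forms of Schröder trees -/

namespace SchroderTree

variable {Q : Type*} [PartialOrder Q] {n : ℕ}

theorem isTerminating_step : IsTerminating (Step (Q := Q) (n := n)) := by
  rintro ⟨f, hf⟩
  have h : ∀ k, (f k).1.numNodes + k ≤ (f 0).1.numNodes := by
    intro k
    induction k with
    | zero => simp
    | succ k ih =>
      have := LTree.Step.numNodes_lt (hf k)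
      omega
  have := h ((f 0).1.numNodes + 1)
  omega

theorem exists_reflTransGen (s : SchroderTree Q n) {t : LTree Q}
    (h : Relation.ReflTransGen LTree.Step s.1 t) :
    ∃ u : SchroderTree Q n, u.1 = t ∧ Relation.ReflTransGen Step s u := by
  induction h with
  | refl => exact ⟨s, rfl, .refl⟩
  | tail _ h ih =>
    obtain ⟨u, rfl, hu⟩ := ih
    exact ⟨⟨_, h.isSchroder u.2.1, h.numLeaves_eq.trans u.2.2⟩, rfl, hu.tail h⟩

theorem reflTransGen_val {s t : SchroderTree Q n} (h : Relation.ReflTransGen Step s t) :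
    Relation.ReflTransGen LTree.Step s.1 t.1 :=
  h.lift Subtype.val fun _ _ h => h

theorem isConfluent_step (hQ : IsForestPoset Q) : IsConfluent (Step (Q := Q) (n := n)) := by
  intro s t u ht hu
  obtain ⟨v, h₁, h₂⟩ := LTree.isConfluent_step hQ _ _ _ (reflTransGen_val ht) (reflTransGen_val hu)
  obtain ⟨v₁, rfl, hv₁⟩ := exists_reflTransGen t h₁
  obtain ⟨v₂, h, hv₂⟩ := exists_reflTransGen u h₂
  exact ⟨v₁, hv₁, Subtype.ext h ▸ hv₂⟩

theorem isNormalForm_iff (t : SchroderTree Q n) : IsNormalForm Step t ↔ t.IsAlternating :=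
  ⟨fun h => LTree.isAlternating_of_forall_not_step _ fun t' ht' =>
    h ⟨t', ht'.isSchroder t.2.1, ht'.numLeaves_eq.trans t.2.2⟩ ht',
    fun h t' => LTree.IsAlternating.not_step h t'.1⟩

theorem _root_.IsNormalForm.eq_of_reflTransGen {S : Type*} {r : S → S → Prop} {s t : S}
    (hs : IsNormalForm r s) (h : Relation.ReflTransGen r s t) : s = t :=
  h.cases_head.elim id fun ⟨u, hu, _⟩ => absurd hu (hs u)

/-- `normalForm` is an arbitrary choice; confluence makes it constant along rewriting. -/
theorem normalForm_eq (hQ : IsForestPoset Q) {s t : SchroderTree Q n}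
    (h : Relation.ReflTransGen LTree.Step s.1 t.1) : s.normalForm = t.normalForm := by
  obtain ⟨u, hu, hsu⟩ := exists_reflTransGen s h
  obtain rfl : u = t := Subtype.ext hu
  obtain ⟨v, h₁, h₂⟩ := isConfluent_step hQ s _ _ s.normalForm_spec.1
    (hsu.trans u.normalForm_spec.1)
  exact (s.normalForm_spec.2.eq_of_reflTransGen h₁).trans
    (u.normalForm_spec.2.eq_of_reflTransGen h₂).symm

theorem normalForm_of_isAlternating {t : SchroderTree Q n} (ht : t.IsAlternating) :
    t.normalForm = t :=
  (((isNormalForm_iff t).2 ht).eq_of_reflTransGen t.normalForm_spec.1).symm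

end SchroderTree

/-! ### The isomorphism -/

section Iso

variable {Q : Type*} [PartialOrder Q]

/-- A syntax tree, seen as a Schröder tree. -/
def SyntaxTree.toSchroder {Q : Type*} {n : ℕ} (t : SyntaxTree Q n) : SchroderTree Q n :=
  ⟨LTree.ofBinary t.1, LTree.isSchroder_ofBinary t.1, (LTree.numLeaves_ofBinary t.1).trans t.2⟩

/-- The normal form of a syntax tree. -/
noncomputable def SyntaxTree.toAlt {n : ℕ} (t : SyntaxTree Q n) : AltSchroderTree Q n :=
  ⟨(SyntaxTree.toSchroder t).normalForm, SchroderTree.isAlternating_normalForm _⟩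

/-- The expansion of an alternating Schröder tree as a syntax tree. -/
def AltSchroderTree.toSyntaxTree {n : ℕ} (t : AltSchroderTree Q n) : SyntaxTree Q n :=
  ⟨LTree.toBinary t.1.1, (LTree.numLeaves_toBinary t.1.2.1).trans t.1.2.2⟩

theorem SyntaxTree.toAlt_eq (hQ : IsForestPoset Q) {n : ℕ} {s t : SyntaxTree Q n} {u : LTree Q}
    (hs : Relation.ReflTransGen LTree.Step (LTree.ofBinary s.1) u)
    (ht : Relation.ReflTransGen LTree.Step (LTree.ofBinary t.1) u) : s.toAlt = t.toAlt := by
  obtain ⟨v, rfl, -⟩ := SchroderTree.exists_reflTransGen (SyntaxTree.toSchroder s) hs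
  exact Subtype.ext ((SchroderTree.normalForm_eq (s := SyntaxTree.toSchroder s) hQ hs).trans
    (SchroderTree.normalForm_eq (s := SyntaxTree.toSchroder t) hQ ht).symm)

theorem AltSchroderTree.toAlt_toSyntaxTree (hQ : IsForestPoset Q) {n : ℕ}
    (t : AltSchroderTree Q n) : t.toSyntaxTree.toAlt = t :=
  Subtype.ext ((SchroderTree.normalForm_eq hQ (s := SyntaxTree.toSchroder t.toSyntaxTree) (t := t.1)
    (LTree.reflTransGen_ofBinary_toBinary t.1.2.1)).trans
    (SchroderTree.normalForm_of_isAlternating t.2))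

/-- Normalizing `t` and then `s` inside the grafting is a chain of steps, so the grafting of the
binary trees rewrites to the grafting of their normal forms, and the two have the same normal form.
-/
theorem SyntaxTree.toAlt_graft (hQ : IsForestPoset Q) {n m p : ℕ} (i : Fin n)
    (h : n + m = p + 1) (s : SyntaxTree Q n) (t : SyntaxTree Q m) :
    (SyntaxTree.graft i h s t).toAlt = AltSchroderTree.comp i h s.toAlt t.toAlt := by
  refine Subtype.ext (SchroderTree.normalForm_eq hQ
    (s := SyntaxTree.toSchroder (SyntaxTree.graft i h s t))
    (t := SchroderTree.graft i h s.toAlt.1 t.toAlt.1) ?_)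
  have hi : (i : ℕ) < s.1.numLeaves := by rw [s.2]; exact i.2
  change Relation.ReflTransGen LTree.Step (LTree.ofBinary (BinaryTree.graft t.1 s.1 i))
    (LTree.graft t.toAlt.1.1 s.toAlt.1.1 i)
  rw [LTree.ofBinary_graft _ _ _ hi]
  refine .trans (b := LTree.graft t.toAlt.1.1 (LTree.ofBinary s.1) i) ?_ ?_
  · exact (SchroderTree.reflTransGen_val (SchroderTree.normalForm_spec (SyntaxTree.toSchroder t)).1).lift
      (fun t => LTree.graft t (LTree.ofBinary s.1) i)
      fun _ _ h => h.graft_right _ _ (by simpa using hi)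
  · exact (SchroderTree.reflTransGen_val (SchroderTree.normalForm_spec (SyntaxTree.toSchroder s)).1).lift
      (fun s => LTree.graft t.toAlt.1.1 s i) fun _ _ h => h.graft_left _ _

-- The two linear maps and their composites

variable (K : Type*) [Field K]

/-- The map from the free operad to `ASchr(Q)`. -/
noncomputable def freeToASchr (n : ℕ) : (freeOperad K Q).space n →ₗ[K] (ASchrOperad K Q).space n :=
  Finsupp.lmapDomain K K (SyntaxTree.toAlt (Q := Q) (n := n))

theorem freeToASchr_single {n : ℕ} (t : SyntaxTree Q n) :
    freeToASchr K n (Finsupp.single t (1 : K)) = Finsupp.single t.toAlt (1 : K) :=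
  Finsupp.mapDomain_single

theorem aSchrOperad_comp_single {n m p : ℕ} (i : Fin n) (h : n + m = p + 1)
    (s : AltSchroderTree Q n) (t : AltSchroderTree Q m) :
    (ASchrOperad K Q).comp i h (Finsupp.single s (1 : K)) (Finsupp.single t (1 : K)) =
      Finsupp.single (AltSchroderTree.comp i h s t) (1 : K) :=
  bilinExt_single K (AltSchroderTree.comp i h) s t

theorem freeToASchr_comp (hQ : IsForestPoset Q) {n m p : ℕ} (i : Fin n) (h : n + m = p + 1)
    (x : (freeOperad K Q).space n) (y : (freeOperad K Q).space m) :
    freeToASchr K p ((freeOperad K Q).comp i h x y) =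
      (ASchrOperad K Q).comp i h (freeToASchr K n x) (freeToASchr K m y) := by
  refine OperadData.map_comp_of_span (fun n => Set.range fun t : SyntaxTree Q n =>
    Finsupp.single t (1 : K)) (fun n => Finsupp.span_range_single_one K (SyntaxTree Q n))
    (freeToASchr K) i h ?_ x y
  rintro _ ⟨s, rfl⟩ _ ⟨t, rfl⟩
  rw [freeOperad_comp_single, freeToASchr_single, freeToASchr_single, freeToASchr_single,
    aSchrOperad_comp_single, SyntaxTree.toAlt_graft hQ]

theorem asRelations_le_ker (hQ : IsForestPoset Q) (n : ℕ) :
    asRelations K Q n ≤ LinearMap.ker (freeToASchr K n) := by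
  refine Submodule.span_le.2 ?_
  rintro x ⟨h, a, b, hab, hx⟩
  obtain rfl : n = 3 := by omega
  -- Every tree in the relations contracts in one step to a corolla with three leaves; the absorbed
  -- label comes first in `upMin`, hence the use of `upMin_comm`.
  have left : ∀ a b : Q, a ≤ b ∨ b ≤ a → Relation.ReflTransGen LTree.Step
      (LTree.ofBinary (SyntaxTree.graft 0 h (corolla a) (corolla b)).1)
      (.node (upMin a b) [.leaf, .leaf, .leaf]) := fun a b hab => by
    rw [upMin_comm hab]
    exact .single (.root b a [] [.leaf, .leaf] [.leaf] hab.symm)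
  have right : ∀ a b : Q, a ≤ b ∨ b ≤ a → Relation.ReflTransGen LTree.Step
      (LTree.ofBinary (SyntaxTree.graft 1 h (corolla a) (corolla b)).1)
      (.node (upMin a b) [.leaf, .leaf, .leaf]) := fun a b hab => by
    rw [upMin_comm hab]
    exact .single (.root b a [.leaf] [.leaf, .leaf] [] hab.symm)
  have key : ∀ a b : Q, freeToASchr K 3 ((freeOperad K Q).comp 0 h (star K a) (star K b)) =
      Finsupp.single (SyntaxTree.graft 0 h (corolla a) (corolla b)).toAlt (1 : K) := fun a b =>
    (congrArg (freeToASchr K 3)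
      (freeOperad_comp_single K 0 h (corolla a) (corolla b))).trans (freeToASchr_single K _)
  have key' : ∀ a b : Q, freeToASchr K 3 ((freeOperad K Q).comp 1 h (star K a) (star K b)) =
      Finsupp.single (SyntaxTree.graft 1 h (corolla a) (corolla b)).toAlt (1 : K) := fun a b =>
    (congrArg (freeToASchr K 3)
      (freeOperad_comp_single K 1 h (corolla a) (corolla b))).trans (freeToASchr_single K _)
  have hm := left (upMin a b) (upMin a b) (.inl le_rfl)
  have hm' := right (upMin a b) (upMin a b) (.inl le_rfl)
  rw [upMin_self] at hm hm'
  rcases hx with rfl | rfl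
  · refine LinearMap.sub_mem_ker_iff.2 ?_
    rw [key, key', SyntaxTree.toAlt_eq hQ (left a b hab) hm']
  · refine LinearMap.sub_mem_ker_iff.2 ?_
    rw [key, key', SyntaxTree.toAlt_eq hQ hm (right a b hab)]

/-- The map from `As(Q)` to `ASchr(Q)`. -/
noncomputable def asToASchr (hQ : IsForestPoset Q) (n : ℕ) :
    (AsOperad K Q).space n →ₗ[K] (ASchrOperad K Q).space n :=
  Submodule.liftQ _ (freeToASchr K n)
    (OperadData.idealSpan_le_ker (freeToASchr K) (freeToASchr_comp K hQ)
      (asRelations_le_ker K hQ) n)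

theorem asToASchr_asClass (hQ : IsForestPoset Q) {n : ℕ} (t : SyntaxTree Q n) :
    asToASchr K hQ n (asClass K t.1 t.2) = Finsupp.single t.toAlt (1 : K) :=
  freeToASchr_single K t

/-- The map from `ASchr(Q)` to `As(Q)`. -/
noncomputable def aSchrToAs (n : ℕ) : (ASchrOperad K Q).space n →ₗ[K] (AsOperad K Q).space n :=
  Finsupp.linearCombination K fun t : AltSchroderTree Q n =>
    asClass K t.toSyntaxTree.1 t.toSyntaxTree.2

theorem aSchrToAs_single {n : ℕ} (t : AltSchroderTree Q n) :
    aSchrToAs K n (Finsupp.single t (1 : K)) = asClass K t.toSyntaxTree.1 t.toSyntaxTree.2 :=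
  (Finsupp.linearCombination_single K _ _).trans (one_smul K _)

/-- The steps from a binary tree to its normal form expand to congruences, and expanding the binary
tree itself returns it unchanged. -/
theorem asClass_toSyntaxTree_toAlt {n : ℕ} (t : SyntaxTree Q n) :
    asClass K t.toAlt.toSyntaxTree.1 t.toAlt.toSyntaxTree.2 = asClass K t.1 t.2 := by
  have h := AsRel.of_reflTransGen_step (SchroderTree.reflTransGen_val
    (SchroderTree.normalForm_spec (SyntaxTree.toSchroder t)).1) (LTree.isSchroder_ofBinary t.1)
  rw [SyntaxTree.toSchroder, LTree.toBinary_ofBinary] at h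
  obtain ⟨_, e⟩ := h.asEq K n t.2
  exact e.symm

/-- The isomorphism between `As(Q)` and `ASchr(Q)`. -/
noncomputable def asIsoASchr (hQ : IsForestPoset Q) : (AsOperad K Q).Iso (ASchrOperad K Q) where
  equiv n := LinearEquiv.ofLinearMap (asToASchr K hQ n) (aSchrToAs K n)
    (by
      refine LinearMap.ext_on_range (Finsupp.span_range_single_one K (AltSchroderTree Q n)) ?_
      intro t
      change asToASchr K hQ n (aSchrToAs K n (Finsupp.single t (1 : K))) = Finsupp.single t (1 : K)
      rw [aSchrToAs_single, asToASchr_asClass, AltSchroderTree.toAlt_toSyntaxTree hQ])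
    (by
      refine LinearMap.ext_on_range (span_range_asClass K Q n) ?_
      intro t
      change aSchrToAs K n (asToASchr K hQ n (asClass K t.1 t.2)) = asClass K t.1 t.2
      rw [asToASchr_asClass, aSchrToAs_single, asClass_toSyntaxTree_toAlt])
  map_one := by
    refine (asToASchr_asClass K hQ ⟨.nil, rfl⟩).trans ?_
    refine congrArg (fun t => Finsupp.single t (1 : K))
      (Subtype.ext ?_ : _ = (⟨SchroderTree.leaf, .leaf⟩ : AltSchroderTree Q 1))
    exact SchroderTree.normalForm_of_isAlternating (t := SchroderTree.leaf) .leaf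
  map_comp i h x y := by
    refine OperadData.map_comp_of_span _ (span_range_asClass K Q) (asToASchr K hQ) i h ?_ x y
    rintro _ ⟨s, rfl⟩ _ ⟨t, rfl⟩
    rw [asToASchr_asClass, asToASchr_asClass, aSchrOperad_comp_single, asOperad_comp_asClass,
      ← SyntaxTree.toAlt_graft hQ]
    exact asToASchr_asClass K hQ (SyntaxTree.graft i h s t)

end Iso

theorem mainTheorem3 (K : Type*) [Field K] [CharZero K] (Q : Type*) [PartialOrder Q] [Finite Q]
    (hQ : IsForestPoset Q) :
    (∀ n : ℕ, IsConvergent (SchroderTree.Step (Q := Q) (n := n)) ∧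
      ∀ t : SchroderTree Q n, IsNormalForm SchroderTree.Step t ↔ t.IsAlternating) ∧
    (AsOperad K Q).IsOperad ∧
    (ASchrOperad K Q).IsOperad ∧
    Nonempty ((AsOperad K Q).Iso (ASchrOperad K Q)) :=
  ⟨fun _ => ⟨⟨SchroderTree.isTerminating_step, SchroderTree.isConfluent_step hQ⟩,
    SchroderTree.isNormalForm_iff⟩, isOperad_asOperad K Q,
    (asIsoASchr K hQ).isOperad (isOperad_asOperad K Q), ⟨asIsoASchr K hQ⟩⟩
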